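/- Let $s\ge 0$ and $r>0$. For $\rho>0$ let $G_s(\rho)$ be the space of formal power series $\sum_k u_kz^k\in\mathbb{C}[[z]]$ of Gevrey order $s$ (that is, $|u_k|\le AC^k\Gamma(1+sk)$ for all $k\in\mathbb{N}_0$, for some $A,C>0$) for which $\sum_k \frac{u_k}{\Gamma(1+sk)}z^k$ is holomorphic on the disc $\{|z|<\rho\}$. Let $G_s[[t]]:=\bigcup_{\rho>0}G_s(\rho)[[t]]$, the space of formal power series in $t$ whose coefficients all lie in $G_s(\rho)$ for a common $\rho>0$. Let $\Delta\subset\mathbb{N}_0\times\mathbb{N}_0$ be finite, let $a_{qr}(t,z)=\sum_{n}a_{q,r,n}(z)t^n\in G_s(r)[[t]]$ be nonzero for $(q,r)\in\Delta$, and let $$P(\partial_t,\partial_z)=\sum_{(q,r)\in\Delta}a_{qr}(t,z)\,\partial_t^q\partial_z^r .$$ Assume that $m:=\max_{(q,r)\in\Delta}(q-\mathrm{ord}_t\,a_{qr})\ge 0$, and let $\partial_t^{-1}$ be integration in $t$ from $0$, so that $P(\partial_t,\partial_z)\partial_t^{-m}$ is a linear operator on $\mathbb{C}[[t,z]]$.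 Put $\Delta_m=\{(q,r)\in\Delta: q-\mathrm{ord}_t\,a_{qr}=m\}$, $\alpha_{q,r}=\mathrm{ord}_z\,a_{q,r,q-m}$, write $a_{q,r,q-m}(z)=z^{\alpha_{q,r}}\tilde a_{q,r,q-m}(z)$ for $(q,r)\in\Delta_m$, and for $n\in\mathbb{N}_0$ put $$\tilde P_m(n,\partial_z)=\sum_{(q,r)\in\Delta_m}n(n-1)\cdots(n-(q-m)+1)\,a_{q,r,q-m}(z)\,\partial_z^r .$$ For each fixed $n$, the Newton polygon $N(\tilde P_m(n,\partial_z))$ of this operator $\sum_r b_r(z)\partial_z^r$ is the convex hull of the union of the sets $\{(x,y)\in\mathbb{R}^2: x\le r,\ y\ge \mathrm{ord}_z b_r-r\}$ over all $r$ with $b_r\ne0$. Put $\Delta_{m,j}=\{(q,r)\in\Delta_m:\alpha_{q,r}-r=j\}$, $l=\min_{(q,r)\in\Delta_m}(\alpha_{q,r}-r)$ and $$W_{m,l}(n,k,0)=\sum_{(q,r)\in\Delta_{m,l}}\tilde a_{q,r,q-m}(0)\,n(n-1)\cdots(n-(q-m)+1)\,k(k-1)\cdots(k-r+1).$$ Assume: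 (a) the lower ordinate (the minimal value of $y$) of $N(\tilde P_m(n,\partial_z))$ is $0$ for every $n\in\mathbb{N}_0$; (b) the first positive slope of $N(\tilde P_m(n,\partial_z))$ is at least $1/s$ for every $n\in\mathbb{N}_0$ (with $1/0=\infty$, and with first positive slope $\infty$ if there is no positive slope); (c) there is $C_0>0$ with $|W_{m,l}(n,k,0)|\ge C_0$ for all $n,k\in\mathbb{N}_0$. Let $p=\max\{r:(q,r)\in\Delta_{m,0}\text{ for some }q\}$, let $\deg w_{ij}=\max\{q-m:(q,i)\in\Delta_{m,j}\}$ (and $\deg w_{ij}=0$ if there is no such $q$), and let $$\alpha=\max\Big(0,\ \max_{j\ge1,\ js\in\mathbb{N}_0}\frac{\deg w_{p+js,j}-\deg w_{p0}}{j}\Big).$$ Then the operator $P(\partial_t,\partial_z)\partial_t^{-m}$ induces a linear automorphism of $G_s[[t]]$ (it maps $G_s[[t]]$ bijectively onto itself) if and only if $\alpha=0$ or, equivalently, if and only if $\deg w_{p+js,j}\le\deg w_{p0}$ for every $j\in\mathbb{N}_0$ with $js\in\mathbb{N}_0$. -/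

import Mathlib

open PowerSeries

namespace GevreyAut

/-! ### Gevrey series -/

/-- A formal power series `∑ uₙ zⁿ` is of Gevrey order `s`: `|uₙ| ≤ A Cⁿ Γ(1 + s n)`. -/
def IsGevrey (s : ℝ) (u : ℂ⟦X⟧) : Prop :=
  ∃ A C : ℝ, 0 < A ∧ 0 < C ∧
    ∀ n : ℕ, ‖PowerSeries.coeff n u‖ ≤ A * C ^ n * Real.Gamma (1 + s * n)

/-- The series `∑ uₙ / Γ(1 + s n) zⁿ` converges on the disc `D_r` to a holomorphic function. -/
def HolomorphicBorel (s r : ℝ) (u : ℂ⟦X⟧) : Prop :=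
  ∃ f : ℂ → ℂ, DifferentiableOn ℂ f (Metric.ball 0 r) ∧
    ∀ z ∈ Metric.ball (0 : ℂ) r,
      HasSum (fun n : ℕ => PowerSeries.coeff n u / (Real.Gamma (1 + s * n) : ℂ) * z ^ n) (f z)

theorem gamma_pos {s : ℝ} (hs : 0 ≤ s) (n : ℕ) : 0 < Real.Gamma (1 + s * n) :=
  Real.Gamma_pos_of_pos (by positivity)

/-- The space `G_s(r)` of series of Gevrey order `s` whose normalised series is in `𝒪(D_r)`. -/
def gevreyDisc (s r : ℝ) (hs : 0 ≤ s) : Submodule ℂ ℂ⟦X⟧ where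
  carrier := {u | IsGevrey s u ∧ HolomorphicBorel s r u}
  zero_mem' := by
    refine ⟨⟨1, 1, one_pos, one_pos, fun n => ?_⟩, fun _ => 0, ?_, fun z _ => ?_⟩
    · simp [(gamma_pos hs n).le]
    · exact differentiableOn_const 0
    · simp
  add_mem' := by
    rintro u v ⟨⟨A, C, hA, hC, h⟩, f, hf, hfs⟩ ⟨⟨A', C', hA', hC', h'⟩, g, hg, hgs⟩
    refine ⟨⟨A + A', max C C', by positivity, by positivity, fun n => ?_⟩,
      f + g, hf.add hg, fun z hz => ?_⟩
    · have hΓ := (gamma_pos hs n).le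
      have h1 : C ^ n ≤ max C C' ^ n := pow_le_pow_left₀ hC.le (le_max_left _ _) n
      have h2 : C' ^ n ≤ max C C' ^ n := pow_le_pow_left₀ hC'.le (le_max_right _ _) n
      calc ‖PowerSeries.coeff n (u + v)‖
          ≤ ‖PowerSeries.coeff n u‖ + ‖PowerSeries.coeff n v‖ := by
            rw [map_add]; exact norm_add_le _ _
        _ ≤ A * C ^ n * Real.Gamma (1 + s * n) + A' * C' ^ n * Real.Gamma (1 + s * n) :=
            add_le_add (h n) (h' n)
        _ ≤ A * max C C' ^ n * Real.Gamma (1 + s * n)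
              + A' * max C C' ^ n * Real.Gamma (1 + s * n) := by gcongr
        _ = (A + A') * max C C' ^ n * Real.Gamma (1 + s * n) := by ring
    · refine ((hfs z hz).add (hgs z hz)).congr_fun ?_
      intro n
      simp only [map_add]
      ring
  smul_mem' := by
    rintro c u ⟨⟨A, C, hA, hC, h⟩, f, hf, hfs⟩
    refine ⟨⟨(‖c‖ + 1) * A, C, by positivity, hC, fun n => ?_⟩,
      fun z => c * f z, hf.const_mul c, fun z hz => ?_⟩
    · have hΓ := (gamma_pos hs n).le
      have h0 : ‖PowerSeries.coeff n (c • u)‖ = ‖c‖ * ‖PowerSeries.coeff n u‖ := by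
        simp
      rw [h0]
      calc ‖c‖ * ‖PowerSeries.coeff n u‖
          ≤ (‖c‖ + 1) * (A * C ^ n * Real.Gamma (1 + s * n)) := by
            gcongr
            · linarith
            · exact h n
        _ = (‖c‖ + 1) * A * C ^ n * Real.Gamma (1 + s * n) := by ring
    · refine ((hfs z hz).mul_left c).congr_fun ?_
      intro n
      simp only [PowerSeries.coeff_smul, smul_eq_mul]
      ring

theorem gevreyDisc_anti {s r r' : ℝ} (hs : 0 ≤ s) (h : r' ≤ r) :
    gevreyDisc s r hs ≤ gevreyDisc s r' hs := by
  rintro u ⟨hu, f, hf, hfs⟩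
  exact ⟨hu, f, hf.mono (Metric.ball_subset_ball h),
    fun z hz => hfs z (Metric.ball_subset_ball h hz)⟩

/-- `G_s[[t]] = ⋃_{ρ > 0} G_s(ρ)[[t]]`: the formal power series in `t` (the outer variable) whose
coefficients, series in `z` (the inner variable), all belong to `G_s(ρ)` for a common `ρ > 0`. -/
def gevreySeries (s : ℝ) (hs : 0 ≤ s) : Submodule ℂ ℂ⟦X⟧⟦X⟧ where
  carrier := {u | ∃ ρ : ℝ, 0 < ρ ∧ ∀ n : ℕ, PowerSeries.coeff n u ∈ gevreyDisc s ρ hs}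
  zero_mem' := ⟨1, one_pos, fun n => by simp⟩
  add_mem' := by
    rintro u v ⟨ρ, hρ, hu⟩ ⟨σ, hσ, hv⟩
    refine ⟨min ρ σ, lt_min hρ hσ, fun n => ?_⟩
    rw [map_add]
    exact Submodule.add_mem _ (gevreyDisc_anti hs (min_le_left _ _) (hu n))
      (gevreyDisc_anti hs (min_le_right _ _) (hv n))
  smul_mem' := by
    rintro c u ⟨ρ, hρ, hu⟩
    exact ⟨ρ, hρ, fun n => Submodule.smul_mem _ c (hu n)⟩

/-! ### The integro-differential operator on `ℂ[[t, z]]` -/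

/-- `∂_t`: the coefficient of `tⁿ` in `∂_t u` is `(n + 1) uₙ₊₁`. -/
noncomputable def dt : ℂ⟦X⟧⟦X⟧ →ₗ[ℂ] ℂ⟦X⟧⟦X⟧ where
  toFun u := PowerSeries.mk fun n => ((n : ℂ) + 1) • PowerSeries.coeff (n + 1) u
  map_add' u v := by ext n : 1; simp
  map_smul' c u := by ext n : 1; simp [smul_comm c]

/-- `∂_z`, acting on each coefficient. -/
noncomputable def dz : ℂ⟦X⟧⟦X⟧ →ₗ[ℂ] ℂ⟦X⟧⟦X⟧ where
  toFun u := PowerSeries.mk fun n => PowerSeries.derivative ℂ (PowerSeries.coeff n u)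
  map_add' u v := by ext n : 1; simp
  map_smul' c u := by ext n : 1; simp

/-- `∂_t⁻¹`, the integration with respect to `t` from `0`: `tⁿ ↦ tⁿ⁺¹ / (n + 1)`. -/
noncomputable def dtInv : ℂ⟦X⟧⟦X⟧ →ₗ[ℂ] ℂ⟦X⟧⟦X⟧ where
  toFun u := PowerSeries.mk fun n =>
    if n = 0 then 0 else (n : ℂ)⁻¹ • PowerSeries.coeff (n - 1) u
  map_add' u v := by
    ext n : 1
    by_cases h : n = 0 <;> simp [h]
  map_smul' c u := by
    ext n : 1
    by_cases h : n = 0 <;> simp [h, smul_comm c]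

/-- `P(∂_t, ∂_z) ∂_t^{-m}` with `P(∂_t, ∂_z) = ∑_{(q,r) ∈ Δ} a_{qr}(t, z) ∂_t^q ∂_z^r`. -/
noncomputable def fullOp (Δ : Finset (ℕ × ℕ)) (a : ℕ × ℕ → ℂ⟦X⟧⟦X⟧) (m : ℕ) :
    ℂ⟦X⟧⟦X⟧ →ₗ[ℂ] ℂ⟦X⟧⟦X⟧ :=
  ∑ d ∈ Δ, LinearMap.mulLeft ℂ (a d) ∘ₗ (dt ^ d.1) ∘ₗ (dz ^ d.2) ∘ₗ (dtInv ^ m)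

/-- The operator `L` on `ℂ[[t, z]]` maps the subspace `V` into itself and induces a linear
automorphism of `V`. -/
def InducesAut (L : ℂ⟦X⟧⟦X⟧ →ₗ[ℂ] ℂ⟦X⟧⟦X⟧) (V : Submodule ℂ ℂ⟦X⟧⟦X⟧) : Prop :=
  ∃ e : V ≃ₗ[ℂ] V, ∀ u : V, ((e u : V) : ℂ⟦X⟧⟦X⟧) = L u

/-! ### The principal part with respect to `∂_t` -/

/-- `ord_t(a_{qr})` (for a nonzero series). -/
noncomputable def ordT (a : ℕ × ℕ → ℂ⟦X⟧⟦X⟧) (d : ℕ × ℕ) : ℕ := (a d).order.toNat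

open Classical in
/-- `Δ_m = {(q, r) ∈ Δ : q - ord_t(a_{qr}) = m}`. -/
noncomputable def deltaM (Δ : Finset (ℕ × ℕ)) (a : ℕ × ℕ → ℂ⟦X⟧⟦X⟧) (m : ℕ) :
    Finset (ℕ × ℕ) :=
  Δ.filter fun d => (d.1 : ℤ) - (ordT a d : ℤ) = (m : ℤ)

/-- `a_{q,r,q-m}(z)`. It is used for `(q, r) ∈ Δ_m` only, where `q - m = ord_t(a_{qr}) ≥ 0`. -/
noncomputable def leadT (a : ℕ × ℕ → ℂ⟦X⟧⟦X⟧) (m : ℕ) (d : ℕ × ℕ) : ℂ⟦X⟧ :=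
  PowerSeries.coeff (d.1 - m) (a d)

/-- `α_{q,r} = ord_z(a_{q,r,q-m})`. -/
noncomputable def ordZ (a : ℕ × ℕ → ℂ⟦X⟧⟦X⟧) (m : ℕ) (d : ℕ × ℕ) : ℕ :=
  (leadT a m d).order.toNat

/-- `ã_{q,r,q-m}(0)`, where `a_{q,r,q-m}(z) = z^{α_{q,r}} ã_{q,r,q-m}(z)`. -/
noncomputable def leadZ (a : ℕ × ℕ → ℂ⟦X⟧⟦X⟧) (m : ℕ) (d : ℕ × ℕ) : ℂ :=
  PowerSeries.coeff (ordZ a m d) (leadT a m d)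

/-- The coefficient of `∂_z^r` in `P̃_m(n, ∂_z)`, namely
`∑_{q : (q, r) ∈ Δ_m} n (n - 1) ⋯ (n - (q - m) + 1) a_{q,r,q-m}(z)`. -/
noncomputable def tildeP (Δ : Finset (ℕ × ℕ)) (a : ℕ × ℕ → ℂ⟦X⟧⟦X⟧) (m n : ℕ) (r : ℕ) : ℂ⟦X⟧ :=
  ∑ d ∈ (deltaM Δ a m).filter (fun d => d.2 = r),
    (n.descFactorial (d.1 - m) : ℂ) • leadT a m d

/-! ### Newton polygons -/

/-- The quadrant `{(x, y) : x ≤ c, y ≥ d}`. -/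
def corner (c d : ℝ) : Set (ℝ × ℝ) := {P | P.1 ≤ c ∧ d ≤ P.2}

/-- The Newton polygon of the differential operator `∑_r b_r(z) ∂_z^r`: the convex hull of the
quadrants with corner `(r, ord_z(b_r) - r)`, over all `r` with `b_r ≠ 0`. (As
`z^r ∂_z^r = (z∂_z)(z∂_z - 1) ⋯ (z∂_z - r + 1)`, rewriting the operator in powers of `z∂_z` only
adds points to the left of those corners, so both forms have the same polygon.) -/
noncomputable def newtonPolygon (b : ℕ → ℂ⟦X⟧) : Set (ℝ × ℝ) :=
  convexHull ℝ (⋃ r ∈ {r : ℕ | b r ≠ 0}, corner (r : ℝ) (((b r).order.toNat : ℝ) - (r : ℝ)))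

/-- `y` is the lower ordinate of the polygon `N`. -/
def IsLowerOrdinate (N : Set (ℝ × ℝ)) (y : ℝ) : Prop := IsLeast (Prod.snd '' N) y

/-- `κ` is the slope of an edge of the convex polygon `N` lying above that edge: a line of slope
`κ` bounds `N` from below and meets `N` in more than one point. -/
def IsSlope (N : Set (ℝ × ℝ)) (κ : ℝ) : Prop :=
  ∃ c : ℝ, (∀ P ∈ N, κ * P.1 + c ≤ P.2) ∧ {P ∈ N | P.2 = κ * P.1 + c}.Nontrivial

/-- The first (smallest) positive slope of `N`; it is `∞` if `N` has no positive slope. -/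
noncomputable def firstPositiveSlope (N : Set (ℝ × ℝ)) : ENNReal :=
  sInf {x | ∃ κ : ℝ, 0 < κ ∧ IsSlope N κ ∧ x = ENNReal.ofReal κ}

/-! ### The principal part with respect to `∂_z`, and the exponent `α` -/

/-- `l = min_{(q, r) ∈ Δ_m} (α_{q,r} - r)`. -/
noncomputable def lowerIndex (Δ : Finset (ℕ × ℕ)) (a : ℕ × ℕ → ℂ⟦X⟧⟦X⟧) (m : ℕ) : ℤ :=
  sInf ((fun d : ℕ × ℕ => (ordZ a m d : ℤ) - (d.2 : ℤ)) '' (deltaM Δ a m : Set (ℕ × ℕ)))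

open Classical in
/-- `Δ_{m,j} = {(q, r) ∈ Δ_m : α_{q,r} - r = j}`. -/
noncomputable def deltaMJ (Δ : Finset (ℕ × ℕ)) (a : ℕ × ℕ → ℂ⟦X⟧⟦X⟧) (m : ℕ) (j : ℤ) :
    Finset (ℕ × ℕ) :=
  (deltaM Δ a m).filter fun d => (ordZ a m d : ℤ) - (d.2 : ℤ) = j

/-- `W_{m,l}(n, k, 0)`. -/
noncomputable def bigW (Δ : Finset (ℕ × ℕ)) (a : ℕ × ℕ → ℂ⟦X⟧⟦X⟧) (m n k : ℕ) : ℂ :=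
  ∑ d ∈ deltaMJ Δ a m (lowerIndex Δ a m),
    leadZ a m d * (n.descFactorial (d.1 - m) : ℂ) * (k.descFactorial d.2 : ℂ)

/-- `p = max {r : (q, r) ∈ Δ_{m,0} for some q}`. -/
noncomputable def pIndex (Δ : Finset (ℕ × ℕ)) (a : ℕ × ℕ → ℂ⟦X⟧⟦X⟧) (m : ℕ) : ℕ :=
  (deltaMJ Δ a m 0).sup Prod.snd

/-- `deg w_{ij} = max {q - m : (q, i) ∈ Δ_{m,j}}`, and `0` if there is no such `q`. -/
noncomputable def degW (Δ : Finset (ℕ × ℕ)) (a : ℕ × ℕ → ℂ⟦X⟧⟦X⟧) (m : ℕ) (i j : ℕ) : ℕ :=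
  ((deltaMJ Δ a m (j : ℤ)).filter (fun d => d.2 = i)).sup (fun d => d.1 - m)

/-- The numbers `0` and `(deg w_{p+js,j} - deg w_{p0}) / j` for `j ≥ 1` with `k = js ∈ ℕ₀`. -/
def alphaSet (Δ : Finset (ℕ × ℕ)) (a : ℕ × ℕ → ℂ⟦X⟧⟦X⟧) (m : ℕ) (s : ℝ) : Set ℝ :=
  insert 0 {x | ∃ j k : ℕ, 1 ≤ j ∧ (k : ℝ) = (j : ℝ) * s ∧
    x = ((degW Δ a m (pIndex Δ a m + k) j : ℝ) - (degW Δ a m (pIndex Δ a m) 0 : ℝ)) / (j : ℝ)}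

/-- `α = max (0, max_{j ≥ 1, js ∈ ℕ₀} (deg w_{p+js,j} - deg w_{p0}) / j)`. -/
noncomputable def alpha (Δ : Finset (ℕ × ℕ)) (a : ℕ × ℕ → ℂ⟦X⟧⟦X⟧) (m : ℕ) (s : ℝ) : ℝ :=
  sSup (alphaSet Δ a m s)

/-- The supremum in `alpha` is that of a bounded set. -/
theorem alphaSet_bddAbove (Δ : Finset (ℕ × ℕ)) (a : ℕ × ℕ → ℂ⟦X⟧⟦X⟧) (m : ℕ) (s : ℝ) :
    BddAbove (alphaSet Δ a m s) := by
  refine ⟨((deltaM Δ a m).sup (fun d => d.1 - m) : ℕ), ?_⟩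
  rintro x (rfl | ⟨j, k, hj, -, rfl⟩)
  · positivity
  · have hj' : (1 : ℝ) ≤ j := by exact_mod_cast hj
    have h1 : degW Δ a m (pIndex Δ a m + k) j ≤ (deltaM Δ a m).sup (fun d => d.1 - m) :=
      Finset.sup_mono ((Finset.filter_subset _ _).trans (Finset.filter_subset _ _))
    have h2 : (degW Δ a m (pIndex Δ a m + k) j : ℝ) ≤
        ((deltaM Δ a m).sup (fun d => d.1 - m) : ℕ) := by exact_mod_cast h1
    rw [div_le_iff₀ (by linarith)]
    have h3 : (0 : ℝ) ≤ (degW Δ a m (pIndex Δ a m) 0 : ℝ) := by positivity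
    have h4 : (0 : ℝ) ≤ ((deltaM Δ a m).sup (fun d => d.1 - m) : ℕ) := by positivity
    nlinarith

end GevreyAut

namespace GevreyAut

open Filter Topology

/-! ### The Gamma function -/

/-! The operator is triangular twice. In powers of t it sends t^n u(z) to t^n P̃_m(n,∂_z)u plus
higher powers (`coeff_fullOp_of_lt`). In powers of z each P̃_m(n,∂_z) is lower triangular, since the
lower ordinate is 0, with diagonal entries W(n,k,0) ≠ 0. So every P̃_m(n,∂_z) is bijective on formal
series, and what remains is whether their inverses preserve G_s(ρ) for one ρ common to all n.

Membership in G_s(ρ) means that |u_k| R^k / Γ(1+sk) is summable for all R < ρ. In this weighted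
basis the slope condition bounds the entry of column k on subdiagonal j by C(2B)^j (k+1)^p R^j, and
this entry divided by k^p tends to |mu_j| R^j, where mu_j sees only the terms with r = p + js
(`SlopeBound.tco_le`, `SlopeBound.tendsto_tco`). For large n, p is `pIndex`, and mu_j is a
polynomial in n whose degree is governed by the numbers deg w_{p+js,j}.

If no degree exceeds deg w_{p0}, then |mu_j| ≤ C(2B)^j |mu_0| uniformly in n (`exists_smallRatio`).
On a small disc, the same for all n, the diagonal dominates all but finitely many columns, and the
inverses preserve G_s(ρ) (`exists_radius_of_smallRatio`).

If some degree is larger, then on any disc, after shrinking R and taking n large, a subdiagonal J ≥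
1 dominates instead. Then some monomial z^K has no preimage in G_s(ρ)
(`eventually_exists_preimage_notMem`). Placing such monomials at a sparse sequence of powers of t,
with radii tending to 0, gives an element of G_s[[t]] whose unique formal preimage lies outside it
(`not_inducesAut_of_triangular`). -/

theorem Gamma_add_le {x y : ℝ} (hx : 0 < x) (hy : 0 ≤ y) :
    Real.Gamma (x + y) ≤ (x + y) ^ y * Real.Gamma x := by
  rcases hy.eq_or_lt with rfl | hy
  · simp
  have h := Real.convexOn_log_Gamma.slope_mono_adjacent (x := x) (y := x + y) (z := x + y + 1)
    (Set.mem_Ioi.2 hx) (Set.mem_Ioi.2 (by linarith)) (by linarith) (by linarith)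
  have hpos : 0 < x + y := by linarith
  simp only [Function.comp, Real.Gamma_add_one hpos.ne',
    Real.log_mul hpos.ne' (Real.Gamma_pos_of_pos hpos).ne', add_sub_cancel_left] at h
  rw [div_le_iff₀ hy] at h
  have h' : Real.log (Real.Gamma (x + y)) ≤ Real.log ((x + y) ^ y * Real.Gamma x) := by
    rw [Real.log_mul (by positivity) (Real.Gamma_pos_of_pos hx).ne', Real.log_rpow hpos]
    nlinarith
  exact (Real.log_le_log_iff (Real.Gamma_pos_of_pos hpos)
    (mul_pos (by positivity) (Real.Gamma_pos_of_pos hx))).1 h'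

/-- By convexity of log Γ its slope on [x, x+1], which is log x, is at most its slope on [x+1,
x+1+y]. -/
theorem rpow_mul_Gamma_le {x y : ℝ} (hx : 0 ≤ x) (hy : 0 ≤ y) :
    x ^ y * Real.Gamma (1 + x) ≤ Real.Gamma (1 + x + y) := by
  rcases hy.eq_or_lt with rfl | hy
  · simp
  rcases hx.eq_or_lt with rfl | hx
  · rw [Real.zero_rpow hy.ne', zero_mul]
    exact (Real.Gamma_pos_of_pos (by linarith)).le
  have h := Real.convexOn_log_Gamma.slope_mono_adjacent (x := x) (y := x + 1) (z := x + 1 + y)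
    (Set.mem_Ioi.2 hx) (Set.mem_Ioi.2 (by linarith)) (by linarith) (by linarith)
  simp only [Function.comp, Real.Gamma_add_one hx.ne',
    Real.log_mul hx.ne' (Real.Gamma_pos_of_pos hx).ne', add_sub_cancel_left] at h
  rw [le_div_iff₀ hy] at h
  rw [add_comm 1 x]
  have hG : 0 < Real.Gamma (x + 1 + y) := Real.Gamma_pos_of_pos (by linarith)
  have hG1 : 0 < Real.Gamma (x + 1) := Real.Gamma_pos_of_pos (by linarith)
  refine (Real.log_le_log_iff (mul_pos (by positivity) hG1) hG).1 ?_
  rw [Real.log_mul (by positivity) hG1.ne', Real.log_rpow hx, Real.Gamma_add_one hx.ne',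
    Real.log_mul hx.ne' (Real.Gamma_pos_of_pos hx).ne']
  nlinarith

/-- The points 1+x+b and 1+y lie between 1+b and 1+x+y and have the same sum, so convexity of log Γ
favours the extreme pair. -/
theorem Gamma_mul_Gamma_le {x y b : ℝ} (hx : 0 ≤ x) (hb : 0 ≤ b) (hby : b ≤ y) :
    Real.Gamma (1 + x + b) * Real.Gamma (1 + y) ≤
      Real.Gamma (1 + x + y) * Real.Gamma (1 + b) := by
  rcases eq_or_lt_of_le (show 0 ≤ x + (y - b) by linarith) with h0 | hpos
  · have h1 : x = 0 := by linarith
    have h2 : y = b := by linarith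
    subst h1 h2
    simp
  have hA : (0 : ℝ) < 1 + b := by linarith
  have hB : (0 : ℝ) < 1 + x + y := by linarith
  have hC : (0 : ℝ) < 1 + x + b := by linarith
  have hD : (0 : ℝ) < 1 + y := by linarith
  have ht : 0 ≤ x / (x + (y - b)) := by positivity
  have ht' : 0 ≤ (y - b) / (x + (y - b)) := div_nonneg (by linarith) hpos.le
  have hs : (y - b) / (x + (y - b)) + x / (x + (y - b)) = 1 := by field_simp; ring
  have h1 := Real.convexOn_log_Gamma.2 (Set.mem_Ioi.2 hA) (Set.mem_Ioi.2 hB) ht' ht hs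
  have h2 := Real.convexOn_log_Gamma.2 (Set.mem_Ioi.2 hA) (Set.mem_Ioi.2 hB) ht ht'
    (by rw [add_comm]; exact hs)
  have e1 : ((y - b) / (x + (y - b))) • (1 + b) + (x / (x + (y - b))) • (1 + x + y)
      = 1 + x + b := by
    simp only [smul_eq_mul]; field_simp; ring
  have e2 : (x / (x + (y - b))) • (1 + b) + ((y - b) / (x + (y - b))) • (1 + x + y)
      = 1 + y := by
    simp only [smul_eq_mul]; field_simp; ring
  rw [e1] at h1
  rw [e2] at h2
  simp only [Function.comp, smul_eq_mul] at h1 h2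
  have gA := Real.Gamma_pos_of_pos hA
  have gB := Real.Gamma_pos_of_pos hB
  have gC := Real.Gamma_pos_of_pos hC
  have gD := Real.Gamma_pos_of_pos hD
  refine (Real.log_le_log_iff (by positivity) (by positivity)).1 ?_
  rw [Real.log_mul gC.ne' gD.ne', Real.log_mul gB.ne' gA.ne']
  have : ∀ p q : ℝ, (y - b) / (x + (y - b)) * p + x / (x + (y - b)) * q
      + (x / (x + (y - b)) * p + (y - b) / (x + (y - b)) * q) = p + q := by
    intro p q
    linear_combination (p + q) * hs
  have := this (Real.log (Real.Gamma (1 + b))) (Real.log (Real.Gamma (1 + x + y)))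
  linarith

/-- The normalising factor `Γ(1 + s k)`. -/
noncomputable def gam (s : ℝ) (k : ℕ) : ℝ := Real.Gamma (1 + s * k)

theorem gam_pos {s : ℝ} (hs : 0 ≤ s) (k : ℕ) : 0 < gam s k := gamma_pos hs k

theorem gam_mul_gam_le {s : ℝ} (hs : 0 ≤ s) (i j : ℕ) : gam s i * gam s j ≤ gam s (i + j) := by
  have := Gamma_mul_Gamma_le (x := s * i) (y := s * j) (b := 0) (by positivity) le_rfl
    (by positivity)
  simp only [add_zero, Real.Gamma_one, mul_one] at this
  unfold gam
  push_cast
  rw [mul_add, ← add_assoc]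
  exact this

theorem gam_add_le {s : ℝ} (hs : 0 ≤ s) (r j : ℕ) :
    gam s (r + j) ≤ (1 + s * (r + j)) ^ (s * r) * gam s j := by
  have := Gamma_add_le (x := 1 + s * j) (y := s * r) (by positivity) (by positivity)
  unfold gam
  push_cast
  rw [show 1 + s * ((r : ℝ) + j) = 1 + s * j + s * r by ring]
  exact this

theorem rpow_mul_gam_le {s : ℝ} (hs : 0 ≤ s) (k j : ℕ) :
    (s * k) ^ (s * j) * gam s k ≤ gam s (k + j) := by
  have := rpow_mul_Gamma_le (x := s * k) (y := s * j) (by positivity) (by positivity)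
  unfold gam
  push_cast
  rw [mul_add, ← add_assoc]
  exact this

/-- `Γ(1 + s k) Γ(1 + s j) k ^ q ≤ C Γ(1 + s (k + j))` if `q ≤ s j`. -/
theorem gam_mul_gam_mul_pow_le {s : ℝ} (hs : 0 ≤ s) (q : ℕ) :
    ∃ C : ℝ, 0 ≤ C ∧ ∀ k j : ℕ, (q : ℝ) ≤ s * j →
      gam s k * gam s j * (k : ℝ) ^ q ≤ C * gam s (k + j) := by
  rcases Nat.eq_zero_or_pos q with rfl | hq
  · exact ⟨1, zero_le_one, fun k j _ => by simpa using gam_mul_gam_le hs k j⟩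
  rcases hs.eq_or_lt with rfl | hs'
  · refine ⟨1, zero_le_one, fun k j h => ?_⟩
    simp at h
    omega
  refine ⟨Real.Gamma (1 + q) / s ^ q, by
    have := (Real.Gamma_pos_of_pos (show (0 : ℝ) < 1 + q by positivity)).le
    positivity, fun k j h => ?_⟩
  -- The factor (sk)^q is absorbed in Γ(1+sk+q); since q ≤ sj, convexity then trades this for
  -- Γ(1+sk+sj) at the cost of Γ(1+q).
  have h1 := Gamma_mul_Gamma_le (x := s * k) (y := s * j) (b := q) (by positivity)
    (by positivity) h
  have h2 := rpow_mul_Gamma_le (x := s * k) (y := q) (by positivity) (by positivity)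
  rw [Real.rpow_natCast, mul_pow] at h2
  have hj := (gam_pos hs j).le
  have h3 : gam s (k + j) = Real.Gamma (1 + s * k + s * j) := by
    unfold gam
    push_cast
    rw [mul_add, ← add_assoc]
  rw [h3, div_mul_eq_mul_div, le_div_iff₀ (by positivity)]
  unfold gam at hj ⊢
  calc _ = s ^ q * (k : ℝ) ^ q * Real.Gamma (1 + s * k) * Real.Gamma (1 + s * j) := by ring
    _ ≤ Real.Gamma (1 + s * k + q) * Real.Gamma (1 + s * j) := by gcongr
    _ ≤ _ := by linarith

/-- `s ^ (- s j)`, the limit of `k ^ (s j) Γ(1 + s k) / Γ(1 + s (k + j))`. -/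
noncomputable def lam (s : ℝ) (j : ℕ) : ℝ := (s ^ (s * j))⁻¹

theorem lam_pos {s : ℝ} (hs : 0 ≤ s) (j : ℕ) : 0 < lam s j := by
  unfold lam
  rcases hs.eq_or_lt with rfl | hs
  · simp
  · positivity

/-- Squeezed between `gam_add_le` from below and `rpow_mul_gam_le` from above. For s = 0 both sides
are 1, by the convention 0^0 = 1. -/
theorem tendsto_gam_ratio {s : ℝ} (hs : 0 ≤ s) (j : ℕ) :
    Tendsto (fun k : ℕ => (k : ℝ) ^ (s * j) * gam s k / gam s (k + j)) atTop (𝓝 (lam s j)) := by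
  rcases hs.eq_or_lt with rfl | hs
  · simp [lam, gam]
  unfold lam
  have hlim : Tendsto (fun k : ℕ => ((k : ℝ) / (1 + s * (j + k))) ^ (s * j)) atTop
      (𝓝 ((s⁻¹) ^ (s * j))) := by
    refine Tendsto.rpow_const ?_ (Or.inr (by positivity))
    have : Tendsto (fun k : ℕ => ((1 + s * j) * ((k : ℝ)⁻¹) + s)⁻¹) atTop (𝓝 s⁻¹) := by
      have h := ((tendsto_inv_atTop_nhds_zero_nat (𝕜 := ℝ)).const_mul (1 + s * j)).add_const s
      rw [mul_zero, zero_add] at h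
      exact h.inv₀ hs.ne'
    refine this.congr' ?_
    filter_upwards [eventually_gt_atTop 0] with k hk
    have hk : (0 : ℝ) < k := by exact_mod_cast hk
    field_simp
    ring
  rw [← Real.inv_rpow hs.le]
  refine tendsto_of_tendsto_of_tendsto_of_le_of_le' hlim tendsto_const_nhds ?_ ?_
  · refine Eventually.of_forall fun k => ?_
    have h := gam_add_le hs.le j k
    have hg := gam_pos hs.le (k + j)
    have hg' := gam_pos hs.le k
    rw [add_comm j k] at h
    rw [Real.div_rpow (by positivity) (by positivity), div_le_div_iff₀ (by positivity) hg]
    calc _ ≤ (k : ℝ) ^ (s * j) * ((1 + s * (j + k)) ^ (s * j) * gam s k) := by gcongr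
      _ = _ := by ring
  · filter_upwards [eventually_gt_atTop 0] with k hk
    have h := rpow_mul_gam_le hs.le k j
    have hg := gam_pos hs.le (k + j)
    have hk : (0 : ℝ) < k := by exact_mod_cast hk
    rw [Real.mul_rpow hs.le hk.le] at h
    rw [Real.inv_rpow hs.le, div_le_iff₀ hg, ← div_eq_inv_mul, le_div_iff₀ (by positivity)]
    linarith

theorem tendsto_descFactorial_div_pow (r : ℕ) :
    Tendsto (fun k : ℕ => (k.descFactorial r : ℝ) / (k : ℝ) ^ r) atTop (𝓝 1) := by
  have h := (Asymptotics.isEquivalent_iff_tendsto_one (by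
    filter_upwards [eventually_gt_atTop 0] with k hk
    positivity)).1 (isEquivalent_descFactorial r)
  exact h

theorem tendsto_descFactorial_div_pow_of_lt {r p : ℕ} (h : r < p) :
    Tendsto (fun k : ℕ => (k.descFactorial r : ℝ) / (k : ℝ) ^ p) atTop (𝓝 0) := by
  have h1 := (tendsto_descFactorial_div_pow r).mul
    ((tendsto_inv_atTop_nhds_zero_nat (𝕜 := ℝ)).pow (p - r))
  rw [zero_pow (by omega), mul_zero] at h1
  refine h1.congr' ?_
  filter_upwards [eventually_gt_atTop 0] with k hk
  have hk : (0 : ℝ) < k := by exact_mod_cast hk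
  rw [show p = r + (p - r) by omega, Nat.add_sub_cancel_left, pow_add, inv_pow]
  field_simp

/-- The contribution of `z ^ (r + j) ∂_z ^ r` to the normalised operator, relative to `k ^ p`. -/
theorem tendsto_term {s : ℝ} (hs : 0 ≤ s) {r p j : ℕ} (h : (r : ℝ) ≤ p + s * j) :
    Tendsto (fun k : ℕ => (k.descFactorial r : ℝ) * gam s k / gam s (k + j) / (k : ℝ) ^ p) atTop
      (𝓝 (if (r : ℝ) = p + s * j then lam s j else 0)) := by
  have h1 := ((tendsto_descFactorial_div_pow r).mul (tendsto_gam_ratio hs j))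
  rw [one_mul] at h1
  have key : ∀ᶠ k : ℕ in atTop, (k.descFactorial r : ℝ) * gam s k / gam s (k + j) / (k : ℝ) ^ p
      = (k.descFactorial r : ℝ) / (k : ℝ) ^ r * ((k : ℝ) ^ (s * j) * gam s k / gam s (k + j))
        * (k : ℝ) ^ (-(p + s * j - r)) := by
    filter_upwards [eventually_gt_atTop 0] with k hk
    have hk : (0 : ℝ) < k := by exact_mod_cast hk
    have hg := (gam_pos hs (k + j)).ne'
    rw [show -((p : ℝ) + s * j - r) = r - (p + s * j) by ring, Real.rpow_sub hk,
      Real.rpow_add hk, Real.rpow_natCast, Real.rpow_natCast]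
    have : (k : ℝ) ^ (s * j) ≠ 0 := by positivity
    field_simp
  rw [tendsto_congr' key]
  split_ifs with he
  · have : -((p : ℝ) + s * j - r) = 0 := by linarith
    simp only [this, Real.rpow_zero, mul_one]
    exact h1
  · have hlt : 0 < (p : ℝ) + s * j - r := by
      have := lt_of_le_of_ne h he
      linarith
    have h2 := (tendsto_rpow_neg_atTop hlt).comp (tendsto_natCast_atTop_atTop (R := ℝ))
    have := h1.mul h2
    rw [mul_zero] at this
    exact this

/-! ### Weighted sums of coefficients -/

/-- The `k`-th coefficient of the normalised series, in absolute value. -/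
noncomputable def nco (s : ℝ) (u : ℂ⟦X⟧) (k : ℕ) : ℝ := ‖PowerSeries.coeff k u‖ / gam s k

theorem nco_nonneg {s : ℝ} (hs : 0 ≤ s) (u : ℂ⟦X⟧) (k : ℕ) : 0 ≤ nco s u k :=
  div_nonneg (norm_nonneg _) (gam_pos hs k).le

/-- Turns a holomorphy condition into weighted ℓ¹ conditions, on which matrix estimates can act. The
Gevrey bound is automatic: it follows from summability at the single radius ρ/2. -/
theorem mem_gevreyDisc_iff {s ρ : ℝ} (hs : 0 ≤ s) (hρ : 0 < ρ) {u : ℂ⟦X⟧} :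
    u ∈ gevreyDisc s ρ hs ↔ ∀ R : ℝ, 0 < R → R < ρ → Summable fun k => nco s u k * R ^ k := by
  have hnorm : ∀ (k : ℕ) (z : ℂ), ‖PowerSeries.coeff k u / (Real.Gamma (1 + s * k) : ℂ) * z ^ k‖
      = nco s u k * ‖z‖ ^ k := by
    intro k z
    rw [norm_mul, norm_div, norm_pow, Complex.norm_real, Real.norm_of_nonneg (gamma_pos hs k).le]
    rfl
  constructor
  · rintro ⟨-, f, -, hf⟩ R hR hRρ
    have hz : (R : ℂ) ∈ Metric.ball (0 : ℂ) ρ := by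
      simp [abs_of_pos hR, hRρ]
    refine (hf R hz).summable.norm.congr fun k => ?_
    rw [hnorm, Complex.norm_real, Real.norm_of_nonneg hR.le]
  · intro h
    refine ⟨?_, fun z => ∑' k, PowerSeries.coeff k u / (Real.Gamma (1 + s * k) : ℂ) * z ^ k,
      ?_, ?_⟩
    · have hR : 0 < ρ / 2 := by positivity
      have hsum := h (ρ / 2) hR (by linarith)
      refine ⟨(∑' k, nco s u k * (ρ / 2) ^ k) + 1, (ρ / 2)⁻¹, ?_, by positivity, fun k => ?_⟩
      · have : 0 ≤ ∑' k, nco s u k * (ρ / 2) ^ k :=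
          tsum_nonneg fun k => mul_nonneg (nco_nonneg hs u k) (by positivity)
        linarith
      · have h1 := hsum.le_tsum k fun i _ => mul_nonneg (nco_nonneg hs u i) (by positivity)
        have hg := gam_pos hs k
        have h2 : nco s u k * (ρ / 2) ^ k ≤ (∑' k, nco s u k * (ρ / 2) ^ k) + 1 := by linarith
        change _ ≤ _ * gam s k
        rw [inv_pow, ← div_eq_mul_inv, ← div_le_iff₀ hg]
        rw [le_div_iff₀ (by positivity)]
        exact h2
    · intro z hz
      have hz' : ‖z‖ < ρ := by simpa using hz
      obtain ⟨R, hzR, hRρ⟩ := exists_between hz'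
      have hR : 0 < R := (norm_nonneg z).trans_lt hzR
      have hd : DifferentiableOn ℂ
          (fun z : ℂ => ∑' k, PowerSeries.coeff k u / (Real.Gamma (1 + s * k) : ℂ) * z ^ k)
          (Metric.ball 0 R) := by
        refine Complex.differentiableOn_tsum_of_summable_norm (h R hR hRρ)
          (fun k => by fun_prop) Metric.isOpen_ball fun k w hw => ?_
        rw [hnorm]
        have := nco_nonneg hs u k
        have hw' : ‖w‖ ≤ R := by simpa using (Metric.mem_ball.1 hw).le
        gcongr
      exact (hd.differentiableAt (Metric.isOpen_ball.mem_nhds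
        (by simpa using hzR))).differentiableWithinAt
    · intro z hz
      have hz' : ‖z‖ < ρ := by simpa using hz
      refine (Summable.of_norm ?_).hasSum
      obtain ⟨R, hzR, hRρ⟩ := exists_between hz'
      have hR : 0 < R := (norm_nonneg z).trans_lt hzR
      refine Summable.of_nonneg_of_le (fun _ => norm_nonneg _) (fun k => ?_) (h R hR hRρ)
      rw [hnorm]
      have := nco_nonneg hs u k
      gcongr

/-- Polynomial factors cost nothing, because the disc is open: they are absorbed by (R/R')^k for
some R' between R and ρ. -/
theorem summable_pow_mul_nco {s ρ R : ℝ} (hs : 0 ≤ s) {u : ℂ⟦X⟧}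
    (hu : u ∈ gevreyDisc s ρ hs) (hR : 0 < R) (hRρ : R < ρ) (q : ℕ) :
    Summable fun k : ℕ => (k : ℝ) ^ q * (nco s u k * R ^ k) := by
  obtain ⟨R', hRR', hR'ρ⟩ := exists_between hRρ
  have hR' := hR.trans hRR'
  have h := (mem_gevreyDisc_iff hs (hR.trans hRρ)).1 hu R' hR' hR'ρ
  have hlt : R / R' < 1 := (div_lt_one hR').2 hRR'
  have ht := tendsto_pow_const_mul_const_pow_of_lt_one q (by positivity : 0 ≤ R / R') hlt
  obtain ⟨M, hM⟩ := ht.bddAbove_range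
  refine Summable.of_nonneg_of_le (fun k => mul_nonneg (by positivity)
    (mul_nonneg (nco_nonneg hs u k) (by positivity))) (fun k => ?_) (h.mul_left M)
  have h1 : (k : ℝ) ^ q * (R / R') ^ k ≤ M := hM ⟨k, rfl⟩
  have h2 := nco_nonneg hs u k
  calc (k : ℝ) ^ q * (nco s u k * R ^ k)
      = ((k : ℝ) ^ q * (R / R') ^ k) * (nco s u k * R' ^ k) := by
        rw [div_pow]; field_simp
    _ ≤ _ := by gcongr

theorem mul_mem_gevreyDisc {s ρ : ℝ} (hs : 0 ≤ s) (hρ : 0 < ρ) {u v : ℂ⟦X⟧}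
    (hu : u ∈ gevreyDisc s ρ hs) (hv : v ∈ gevreyDisc s ρ hs) : u * v ∈ gevreyDisc s ρ hs := by
  rw [mem_gevreyDisc_iff hs hρ] at hu hv ⊢
  intro R hR hRρ
  have hm : Summable fun x : ℕ × ℕ => (nco s u x.1 * R ^ x.1) * (nco s v x.2 * R ^ x.2) :=
    (hu R hR hRρ).mul_of_nonneg (hv R hR hRρ)
      (fun k => mul_nonneg (nco_nonneg hs _ k) (by positivity))
      (fun k => mul_nonneg (nco_nonneg hs _ k) (by positivity))
  have hp : Summable fun n => ∑ ij ∈ Finset.HasAntidiagonal.antidiagonal n,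
      (nco s u ij.1 * R ^ ij.1) * (nco s v ij.2 * R ^ ij.2) :=
    summable_sum_mul_antidiagonal_of_summable_mul (f := fun k => nco s u k * R ^ k)
      (g := fun k => nco s v k * R ^ k) hm
  refine Summable.of_nonneg_of_le (fun k => mul_nonneg (nco_nonneg hs _ k) (by positivity))
    (fun k => ?_) hp
  unfold nco
  rw [PowerSeries.coeff_mul, div_mul_eq_mul_div, div_le_iff₀ (gam_pos hs k)]
  calc _ ≤ (∑ ij ∈ Finset.HasAntidiagonal.antidiagonal k,
        ‖PowerSeries.coeff ij.1 u * PowerSeries.coeff ij.2 v‖) * R ^ k := by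
        gcongr
        exact norm_sum_le _ _
    _ ≤ _ := by
        rw [Finset.sum_mul, Finset.sum_mul]
        refine Finset.sum_le_sum fun ij hij => ?_
        rw [Finset.HasAntidiagonal.mem_antidiagonal] at hij
        have h := gam_mul_gam_le hs ij.1 ij.2
        have g1 := gam_pos hs ij.1
        have g2 := gam_pos hs ij.2
        rw [← hij, norm_mul, pow_add]
        calc _ = ‖PowerSeries.coeff ij.1 u‖ / gam s ij.1 * R ^ ij.1 *
              (‖PowerSeries.coeff ij.2 v‖ / gam s ij.2 * R ^ ij.2) *
                (gam s ij.1 * gam s ij.2) := by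
              field_simp
          _ ≤ _ := by gcongr

theorem derivative_mem_gevreyDisc {s ρ : ℝ} (hs : 0 ≤ s) (hρ : 0 < ρ) {u : ℂ⟦X⟧}
    (hu : u ∈ gevreyDisc s ρ hs) : PowerSeries.derivative ℂ u ∈ gevreyDisc s ρ hs := by
  rw [mem_gevreyDisc_iff hs hρ]
  intro R hR hRρ
  obtain ⟨N, hN⟩ := exists_nat_ge s
  have h1 := (((summable_nat_add_iff 1).2
    (summable_pow_mul_nco hs hu hR hRρ (N + 1))).mul_left ((1 + s) ^ N / R))
  refine Summable.of_nonneg_of_le (fun k => mul_nonneg (nco_nonneg hs _ k) (by positivity))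
    (fun k => ?_) h1
  have g1 := gam_pos hs (k + 1)
  have g0 := gam_pos hs k
  have hg : gam s (k + 1) ≤ ((1 + s) * (k + 1)) ^ N * gam s k := by
    have h := gam_add_le hs 1 k
    rw [add_comm 1 k] at h
    refine h.trans ?_
    gcongr
    have hb : (1 : ℝ) + s * ((1 : ℕ) + k) ≤ (1 + s) * (k + 1) := by
      push_cast
      nlinarith [show (0 : ℝ) ≤ k from by positivity]
    have h1' : (1 : ℝ) ≤ (1 + s) * (k + 1) := by
      nlinarith [show (0 : ℝ) ≤ k from by positivity,
        mul_nonneg hs (show (0 : ℝ) ≤ k from by positivity)]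
    calc _ ≤ ((1 + s) * ((k : ℝ) + 1)) ^ (s * (1 : ℕ)) := by gcongr
      _ ≤ ((1 + s) * ((k : ℝ) + 1)) ^ (N : ℝ) := by
        apply Real.rpow_le_rpow_of_exponent_le h1'
        simpa using hN
      _ = _ := Real.rpow_natCast _ _
  unfold nco
  rw [PowerSeries.coeff_derivative, norm_mul]
  have hn : ‖((k : ℂ) + 1)‖ = (k : ℝ) + 1 := by
    have : ((k : ℂ) + 1) = ((k + 1 : ℕ) : ℂ) := by push_cast; rfl
    rw [this, Complex.norm_natCast]
    push_cast
    rfl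
  rw [hn]
  push_cast
  calc ‖PowerSeries.coeff (k + 1) u‖ * (k + 1) / gam s k * R ^ k
      = ‖PowerSeries.coeff (k + 1) u‖ * (k + 1) * R ^ k / (gam s k * gam s (k + 1))
          * gam s (k + 1) := by field_simp
    _ ≤ ‖PowerSeries.coeff (k + 1) u‖ * (k + 1) * R ^ k / (gam s k * gam s (k + 1))
          * (((1 + s) * (k + 1)) ^ N * gam s k) := by gcongr
    _ = _ := by
      rw [mul_pow, pow_succ, pow_succ R k]
      field_simp

theorem X_pow_mem_gevreyDisc {s ρ : ℝ} (hs : 0 ≤ s) (hρ : 0 < ρ) (K : ℕ) :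
    (X ^ K : ℂ⟦X⟧) ∈ gevreyDisc s ρ hs := by
  rw [mem_gevreyDisc_iff hs hρ]
  intro R _ _
  refine summable_of_ne_finset_zero (s := {K}) fun k hk => ?_
  have : k ≠ K := by simpa using hk
  simp [nco, PowerSeries.coeff_X_pow, this]

/-! ### Dominant diagonals -/

/-- Here `T k j` is the size of the entry of column k on subdiagonal j, and `h` is row k+J solved
for its entry on subdiagonal J. Summing over rows and exchanging the sums charges each column i with
the sum of its entries off subdiagonal J. Columns up to M+J occur, not only up to M. -/
theorem sum_diagonal_le {T : ℕ → ℕ → ℝ} {x F : ℕ → ℝ} (J : ℕ) (hT0 : ∀ k j, 0 ≤ T k j)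
    (hx0 : ∀ k, 0 ≤ x k) (hT : ∀ k, Summable (T k))
    (h : ∀ k, T k J * x k ≤
      F (k + J) + ∑ i ∈ (Finset.range (k + J + 1)).erase k, T i (k + J - i) * x i) (M : ℕ) :
    ∑ k ∈ Finset.range M, T k J * x k ≤ ∑ k ∈ Finset.range M, F (k + J) +
      ∑ k ∈ Finset.range (M + J), x k * ∑' j, if j = J then 0 else T k j := by
  have h1 : ∑ k ∈ Finset.range M, T k J * x k ≤ ∑ k ∈ Finset.range M, F (k + J) +
      ∑ k ∈ Finset.range M, ∑ i ∈ Finset.range (M + J),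
        x i * if i ≤ k + J ∧ i ≠ k then T i (k + J - i) else 0 := by
    rw [← Finset.sum_add_distrib]
    refine Finset.sum_le_sum fun k hk => (h k).trans (add_le_add_right (le_of_eq ?_) _)
    have hk' : k < M := Finset.mem_range.1 hk
    rw [← Finset.sum_subset (s₁ := (Finset.range (k + J + 1)).erase k)
      (s₂ := Finset.range (M + J))]
    · refine Finset.sum_congr rfl fun i hi => ?_
      rw [Finset.mem_erase, Finset.mem_range] at hi
      rw [if_pos ⟨by omega, hi.1⟩, mul_comm]
    · intro i hi
      rw [Finset.mem_erase, Finset.mem_range] at hi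
      rw [Finset.mem_range]
      omega
    · intro i _ hi
      rw [Finset.mem_erase, Finset.mem_range] at hi
      rw [if_neg (by rintro ⟨h1, h2⟩; exact hi ⟨h2, by omega⟩), mul_zero]
  refine h1.trans (add_le_add_right ?_ _)
  rw [Finset.sum_comm]
  refine Finset.sum_le_sum fun i _ => ?_
  rw [← Finset.mul_sum]
  refine mul_le_mul_of_nonneg_left ?_ (hx0 i)
  have hs : Summable fun j => if j = J then 0 else T i j := by
    refine Summable.of_nonneg_of_le (fun j => ?_) (fun j => ?_) (hT i)
    · split_ifs <;> simp [hT0]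
    · split_ifs <;> simp [hT0]
  rw [← Finset.sum_filter]
  have hinj : Set.InjOn (fun k => k + J - i)
      (((Finset.range M).filter fun k => i ≤ k + J ∧ i ≠ k : Finset ℕ) : Set ℕ) := by
    intro a ha b hb hab
    simp only [Finset.coe_filter, Set.mem_ofPred_eq] at ha hb hab
    omega
  have h2 : ∑ k ∈ (Finset.range M).filter (fun k => i ≤ k + J ∧ i ≠ k), T i (k + J - i)
      = ∑ j ∈ ((Finset.range M).filter (fun k => i ≤ k + J ∧ i ≠ k)).image
          (fun k => k + J - i), if j = J then 0 else T i j := by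
    rw [Finset.sum_image hinj]
    refine Finset.sum_congr rfl fun k hk => ?_
    rw [Finset.mem_filter] at hk
    rw [if_neg (by omega)]
  rw [h2]
  refine hs.sum_le_tsum _ fun j _ => ?_
  split_ifs <;> simp [hT0]

/-- For J = 0 the same columns occur on both sides, so half of the left side absorbs the columns k ≥
K, and the finitely many others contribute the constant `E`. No convergence of x has to be known
beforehand. -/
theorem summable_of_diagonal_zero {T : ℕ → ℕ → ℝ} {x F : ℕ → ℝ} (hT0 : ∀ k j, 0 ≤ T k j)
    (hx0 : ∀ k, 0 ≤ x k) (hF0 : ∀ k, 0 ≤ F k) (hT : ∀ k, Summable (T k))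
    (h : ∀ k, T k 0 * x k ≤
      F k + ∑ i ∈ (Finset.range (k + 1)).erase k, T i (k - i) * x i)
    (hF : Summable F) {K : ℕ}
    (hdom : ∀ k, K ≤ k → (∑' j, if j = 0 then 0 else T k j) ≤ 1 / 2 * T k 0)
    {c : ℝ} (hc : 0 < c) (hTc : ∀ k, c ≤ T k 0) : Summable x := by
  have h0 : ∀ k, 0 ≤ ∑' j, if j = 0 then 0 else T k j := fun k => tsum_nonneg fun j => by
    split_ifs <;> simp [hT0]
  set E : ℝ := ∑ k ∈ Finset.range K, x k * ∑' j, if j = 0 then 0 else T k j with hE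
  refine summable_of_sum_range_le (c := 2 * (tsum F + E) / c) hx0 fun M => ?_
  have h1 := sum_diagonal_le (F := F) 0 hT0 hx0 hT h M
  simp only [add_zero] at h1
  have h2 : ∑ k ∈ Finset.range M, x k * (∑' j, if j = 0 then 0 else T k j) ≤
      E + 1 / 2 * ∑ k ∈ Finset.range M, T k 0 * x k := by
    rw [hE]
    calc _ ≤ ∑ k ∈ Finset.range M,
          ((if k < K then x k * (∑' j, if j = 0 then 0 else T k j) else 0)
            + 1 / 2 * (T k 0 * x k)) := by
          refine Finset.sum_le_sum fun k _ => ?_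
          split_ifs with hk
          · have := mul_nonneg (hT0 k 0) (hx0 k)
            linarith
          · have := mul_le_mul_of_nonneg_left (hdom k (not_lt.1 hk)) (hx0 k)
            linarith
      _ ≤ _ := by
          rw [Finset.sum_add_distrib, ← Finset.sum_filter, ← Finset.mul_sum]
          refine add_le_add_left ?_ _
          refine Finset.sum_le_sum_of_subset_of_nonneg (fun k hk => ?_) fun k _ _ =>
            mul_nonneg (hx0 k) (h0 k)
          simp at hk ⊢
          exact hk.2
  have h3 := hF.sum_le_tsum (Finset.range M) fun k _ => hF0 k
  have h4 : c * ∑ k ∈ Finset.range M, x k ≤ ∑ k ∈ Finset.range M, T k 0 * x k := by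
    rw [Finset.mul_sum]
    exact Finset.sum_le_sum fun k _ => mul_le_mul_of_nonneg_right (hTc k) (hx0 k)
  rw [le_div_iff₀ hc]
  linarith

/-- For J > 0 the right side involves J more columns than the left, so partial sums cannot be
absorbed. Summability is therefore assumed, and the limit S satisfies 0 ≤ S ≤ θS, hence S = 0. -/
theorem diagonal_eq_zero {T : ℕ → ℕ → ℝ} {x : ℕ → ℝ} {J : ℕ} (hT0 : ∀ k j, 0 ≤ T k j)
    (hx0 : ∀ k, 0 ≤ x k) (hT : ∀ k, Summable (T k))
    (h : ∀ k, T k J * x k ≤ ∑ i ∈ (Finset.range (k + J + 1)).erase k, T i (k + J - i) * x i)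
    {θ : ℝ} (hθ : θ < 1)
    (hdom : ∀ k, x k ≠ 0 → (∑' j, if j = J then 0 else T k j) ≤ θ * T k J)
    (hS : Summable fun k => T k J * x k) (k : ℕ) : T k J * x k = 0 := by
  have hn : ∀ k, 0 ≤ T k J * x k := fun k => mul_nonneg (hT0 k J) (hx0 k)
  have h1 : ∀ M, ∑ k ∈ Finset.range M, T k J * x k ≤
      θ * ∑ k ∈ Finset.range (M + J), T k J * x k := by
    intro M
    refine (sum_diagonal_le (F := fun _ => 0) J hT0 hx0 hT (by simpa using h) M).trans ?_
    rw [Finset.sum_const_zero, zero_add, Finset.mul_sum]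
    refine Finset.sum_le_sum fun k _ => ?_
    by_cases hk : x k = 0
    · simp [hk]
    · have := mul_le_mul_of_nonneg_left (hdom k hk) (hx0 k)
      linarith
  have h2 := hS.hasSum.tendsto_sum_nat
  have h3 := ((tendsto_add_atTop_iff_nat J).2 h2).const_mul θ
  have h4 := le_of_tendsto_of_tendsto' h2 h3 h1
  have h5 : 0 ≤ ∑' k, T k J * x k := tsum_nonneg hn
  have h6 : ∑' k, T k J * x k ≤ 0 := by nlinarith
  have := hS.le_tsum k fun i _ => hn i
  exact le_antisymm (this.trans h6) (hn k)

/-! ### Ordinary differential operators `∑_{r < N} b_r(z) ∂_z^r` -/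

/-- The operator `∑_{r < N} b_r(z) ∂_z^r`. -/
noncomputable def diffOp (b : ℕ → ℂ⟦X⟧) (N : ℕ) (u : ℂ⟦X⟧) : ℂ⟦X⟧ :=
  ∑ r ∈ Finset.range N, b r * (PowerSeries.derivative ℂ)^[r] u

/-- The coefficient of `z ^ (k + j)` in the image of `z ^ k` under `diffOp b N`. -/
noncomputable def opCoeff (b : ℕ → ℂ⟦X⟧) (N j k : ℕ) : ℂ :=
  ∑ r ∈ Finset.range N, (k.descFactorial r : ℂ) * PowerSeries.coeff (r + j) (b r)

/-- As A is divisible by z^r, the factor z^r can be moved onto ∂_z^r, and z^r ∂_z^r acts diagonally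
on monomials. -/
theorem coeff_mul_iterate_derivative {A : ℂ⟦X⟧} {r : ℕ}
    (hA : ∀ i < r, PowerSeries.coeff i A = 0) (u : ℂ⟦X⟧) (i : ℕ) :
    PowerSeries.coeff i (A * (PowerSeries.derivative ℂ)^[r] u) =
      ∑ k ∈ Finset.range (i + 1),
        (k.descFactorial r : ℂ) * PowerSeries.coeff (r + (i - k)) A * PowerSeries.coeff k u := by
  have h1 : A = X ^ r * PowerSeries.mk fun j => PowerSeries.coeff (r + j) A := by
    ext k
    rw [PowerSeries.coeff_X_pow_mul']
    split_ifs with hk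
    · rw [PowerSeries.coeff_mk]
      congr 2
      omega
    · exact hA k (not_le.1 hk)
  have h2 : X ^ r * (PowerSeries.derivative ℂ)^[r] u =
      PowerSeries.mk fun k => (k.descFactorial r : ℂ) * PowerSeries.coeff k u := by
    ext k
    rw [PowerSeries.coeff_X_pow_mul', PowerSeries.coeff_mk]
    split_ifs with hk
    · obtain ⟨l, rfl⟩ := Nat.exists_eq_add_of_le' hk
      rw [PowerSeries.coeff_iterate_derivative, Nat.add_descFactorial_eq_ascFactorial]
      simp
    · simp [Nat.descFactorial_of_lt (not_le.1 hk)]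
  have h3 : A * (PowerSeries.derivative ℂ)^[r] u =
      (PowerSeries.mk fun k => (k.descFactorial r : ℂ) * PowerSeries.coeff k u) *
        PowerSeries.mk fun j => PowerSeries.coeff (r + j) A := by
    rw [← h2]
    conv_lhs => rw [h1]
    ring
  rw [h3, PowerSeries.coeff_mul, Finset.Nat.sum_antidiagonal_eq_sum_range_succ_mk]
  refine Finset.sum_congr rfl fun k _ => ?_
  simp only [PowerSeries.coeff_mk]
  ring

theorem coeff_diffOp {b : ℕ → ℂ⟦X⟧} (hb : ∀ r, ∀ i < r, PowerSeries.coeff i (b r) = 0)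
    (N : ℕ) (u : ℂ⟦X⟧) (i : ℕ) :
    PowerSeries.coeff i (diffOp b N u) =
      ∑ k ∈ Finset.range (i + 1), opCoeff b N (i - k) k * PowerSeries.coeff k u := by
  unfold diffOp opCoeff
  simp only [map_sum, Finset.sum_mul]
  rw [Finset.sum_comm]
  exact Finset.sum_congr rfl fun r _ => coeff_mul_iterate_derivative (hb r) u i

theorem diffOp_bijective {b : ℕ → ℂ⟦X⟧} (hb : ∀ r, ∀ i < r, PowerSeries.coeff i (b r) = 0)
    {N : ℕ} (h0 : ∀ k, opCoeff b N 0 k ≠ 0) : Function.Bijective (diffOp b N) := by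
  constructor
  · intro u v huv
    ext i
    induction i using Nat.strong_induction_on with
    | _ i ih =>
      have h := congrArg (PowerSeries.coeff i) huv
      rw [coeff_diffOp hb, coeff_diffOp hb, Finset.sum_range_succ, Finset.sum_range_succ,
        Finset.sum_congr rfl fun k hk => by rw [ih k (Finset.mem_range.1 hk)]] at h
      simpa [h0] using h
  · intro f
    let c : (i : ℕ) → ((k : ℕ) → k < i → ℂ) → ℂ := fun i w =>
      (opCoeff b N 0 i)⁻¹ * (PowerSeries.coeff i f -
        ∑ k ∈ (Finset.range i).attach, opCoeff b N (i - k) k * w k (Finset.mem_range.1 k.2))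
    let w : ℕ → ℂ := fun i => Nat.strongRec (motive := fun _ => ℂ) c i
    have hw : ∀ i, w i = (opCoeff b N 0 i)⁻¹ * (PowerSeries.coeff i f -
        ∑ k ∈ Finset.range i, opCoeff b N (i - k) k * w k) := by
      intro i
      have : w i = c i fun k _ => w k := by
        simp only [w]
        rw [Nat.strongRec]
      rw [this]
      simp only [c]
      rw [Finset.sum_attach (Finset.range i) fun k => opCoeff b N (i - k) k * w k]
    refine ⟨PowerSeries.mk w, ?_⟩
    ext i
    rw [coeff_diffOp hb, Finset.sum_range_succ]
    simp only [PowerSeries.coeff_mk, Nat.sub_self]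
    rw [hw i, mul_inv_cancel_left₀ (h0 i)]
    ring

/-- Bounds on the coefficients `b_r` of an operator whose Newton polygon has the vertex `(p, 0)`
and positive slopes at least `1 / s` only. -/
structure SlopeBound (s : ℝ) (b : ℕ → ℂ⟦X⟧) (p : ℕ) (A B : ℝ) : Prop where
  ord : ∀ r, ∀ i < r, PowerSeries.coeff i (b r) = 0
  slope : ∀ r j, PowerSeries.coeff (r + j) (b r) ≠ 0 → (r : ℝ) ≤ p + s * j
  gevrey : ∀ r i, ‖PowerSeries.coeff i (b r)‖ ≤ A * B ^ i * gam s i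

/-- The matrix entries in the normalised basis, in absolute value. -/
noncomputable def tco (s : ℝ) (b : ℕ → ℂ⟦X⟧) (N j k : ℕ) : ℝ :=
  ‖opCoeff b N j k‖ * gam s k / gam s (k + j)

theorem tco_nonneg {s : ℝ} (hs : 0 ≤ s) (b : ℕ → ℂ⟦X⟧) (N j k : ℕ) : 0 ≤ tco s b N j k := by
  have := gam_pos hs k
  have := gam_pos hs (k + j)
  unfold tco
  positivity

/-- The limit of the normalised matrix entries on the `j`-th subdiagonal, relative to `k ^ p`. -/
noncomputable def mu (s : ℝ) (b : ℕ → ℂ⟦X⟧) (N p j : ℕ) : ℂ :=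
  ∑ r ∈ Finset.range N,
    if (r : ℝ) = p + s * j then (lam s j : ℂ) * PowerSeries.coeff (r + j) (b r) else 0

theorem gam_mul_gam_mul_succ_pow_le {s : ℝ} (hs : 0 ≤ s) (q : ℕ) :
    ∃ C : ℝ, 0 ≤ C ∧ ∀ k j : ℕ, (q : ℝ) ≤ s * j →
      gam s k * gam s j * ((k : ℝ) + 1) ^ q ≤ C * gam s (k + j) := by
  obtain ⟨C, hC, h⟩ := gam_mul_gam_mul_pow_le hs q
  refine ⟨2 ^ q * C + 1, by positivity, fun k j hj => ?_⟩
  have g := gam_pos hs (k + j)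
  rcases Nat.eq_zero_or_pos k with rfl | hk
  · have h0 : gam s 0 = 1 := by simp [gam]
    have : 0 ≤ 2 ^ q * C * gam s (0 + j) := by positivity
    simp only [h0, one_mul, Nat.cast_zero, zero_add, one_pow, mul_one] at this ⊢
    linarith
  · have hk' : (k : ℝ) + 1 ≤ 2 * k := by
      have : (1 : ℝ) ≤ k := by exact_mod_cast hk
      linarith
    have gk := gam_pos hs k
    have gj := gam_pos hs j
    calc gam s k * gam s j * ((k : ℝ) + 1) ^ q
        ≤ gam s k * gam s j * (2 * (k : ℝ)) ^ q := by gcongr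
      _ = 2 ^ q * (gam s k * gam s j * (k : ℝ) ^ q) := by rw [mul_pow]; ring
      _ ≤ 2 ^ q * (C * gam s (k + j)) :=
          mul_le_mul_of_nonneg_left (h k j hj) (by positivity)
      _ ≤ _ := by linarith

/-- The quotient of the two Gamma values grows polynomially in j, hence is bounded by a multiple of
2^j. This is the source of the 2 in the rates (2B)^j below. -/
theorem gam_add_le_two_pow {s : ℝ} (hs : 0 ≤ s) (r : ℕ) :
    ∃ C : ℝ, 0 ≤ C ∧ ∀ j : ℕ, gam s (r + j) ≤ C * 2 ^ j * gam s j := by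
  obtain ⟨N, hN⟩ := exists_nat_ge (s * r)
  have ht := tendsto_pow_const_mul_const_pow_of_lt_one N (by norm_num : (0 : ℝ) ≤ 1 / 2)
    (by norm_num)
  obtain ⟨M, hM⟩ := ht.bddAbove_range
  have hM' : ∀ j : ℕ, ((j : ℝ) + 1) ^ N ≤ 2 * M * 2 ^ j := by
    intro j
    have h : ((j + 1 : ℕ) : ℝ) ^ N * (1 / 2) ^ (j + 1) ≤ M := hM ⟨j + 1, rfl⟩
    push_cast at h
    rw [one_div, inv_pow, ← div_eq_mul_inv, div_le_iff₀ (by positivity), pow_succ] at h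
    linarith
  have hM0 : 0 ≤ M := by
    have := hM' 0
    simp at this
    linarith
  refine ⟨(1 + s * (r + 1)) ^ N * (2 * M), by positivity, fun j => ?_⟩
  have gj := gam_pos hs j
  refine (gam_add_le hs r j).trans ?_
  gcongr
  have hj : (0 : ℝ) ≤ j := by positivity
  have hr : (0 : ℝ) ≤ r := by positivity
  have hb : 1 + s * ((r : ℝ) + j) ≤ (1 + s * (r + 1)) * (j + 1) := by
    nlinarith [mul_nonneg (mul_nonneg hs hr) hj]
  have h1 : 1 ≤ 1 + s * ((r : ℝ) + j) := by
    have : 0 ≤ s * ((r : ℝ) + j) := by positivity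
    linarith
  calc (1 + s * ((r : ℝ) + j)) ^ (s * r) ≤ (1 + s * ((r : ℝ) + j)) ^ (N : ℝ) :=
        Real.rpow_le_rpow_of_exponent_le h1 hN
    _ = (1 + s * ((r : ℝ) + j)) ^ N := Real.rpow_natCast _ _
    _ ≤ ((1 + s * (r + 1)) * (j + 1)) ^ N := by gcongr
    _ = (1 + s * (r + 1)) ^ N * ((j : ℝ) + 1) ^ N := mul_pow _ _ _
    _ ≤ _ := by
        rw [mul_assoc]
        gcongr
        exact hM' j

/-! ### Matrix estimates for a single operator in the normalised basis -/

namespace SlopeBound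

variable {s : ℝ} {b : ℕ → ℂ⟦X⟧} {p : ℕ} {A B : ℝ}

/-- A term of order r contributes k^r, of which only k^p is allowed. The slope bound says that the
excess r - p is at most sj, and the quotient Γ(1+sk)Γ(1+sj)/Γ(1+s(k+j)) absorbs exactly such a power
of k. For r ≤ p the truncated difference is 0. -/
theorem tco_le (h : SlopeBound s b p A B) (hs : 0 ≤ s) (hA : 0 ≤ A) (hB : 0 ≤ B) (N : ℕ) :
    ∃ C : ℝ, 0 ≤ C ∧ ∀ k j : ℕ, tco s b N j k ≤ C * (2 * B) ^ j * ((k : ℝ) + 1) ^ p := by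
  choose C1 hC1 h1 using fun q => gam_mul_gam_mul_succ_pow_le hs q
  choose C2 hC2 h2 using fun r => gam_add_le_two_pow hs r
  refine ⟨∑ r ∈ Finset.range N, A * B ^ r * C2 r * C1 (r - p),
    Finset.sum_nonneg fun r _ => by have := hC1 (r - p); have := hC2 r; positivity,
    fun k j => ?_⟩
  have gk := gam_pos hs k
  have gj := gam_pos hs j
  have gkj := gam_pos hs (k + j)
  unfold tco opCoeff
  rw [div_le_iff₀ gkj]
  calc _ ≤ (∑ r ∈ Finset.range N,
        ‖(k.descFactorial r : ℂ) * PowerSeries.coeff (r + j) (b r)‖) * gam s k := by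
        gcongr
        exact norm_sum_le _ _
    _ ≤ _ := by
        rw [Finset.sum_mul, Finset.sum_mul, Finset.sum_mul, Finset.sum_mul]
        refine Finset.sum_le_sum fun r _ => ?_
        have c1 := hC1 (r - p)
        have c2 := hC2 r
        by_cases h0 : PowerSeries.coeff (r + j) (b r) = 0
        · rw [h0, mul_zero, norm_zero, zero_mul]
          positivity
        have hq : ((r - p : ℕ) : ℝ) ≤ s * j := by
          rcases le_total r p with hrp | hrp
          · rw [Nat.sub_eq_zero_of_le hrp]
            simp only [Nat.cast_zero]
            positivity
          · rw [Nat.cast_sub hrp]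
            linarith [h.slope r j h0]
        have hd : (k.descFactorial r : ℝ) ≤ ((k : ℝ) + 1) ^ (r - p) * ((k : ℝ) + 1) ^ p := by
          rw [← pow_add]
          calc (k.descFactorial r : ℝ) ≤ (k : ℝ) ^ r := by
                exact_mod_cast Nat.descFactorial_le_pow k r
            _ ≤ ((k : ℝ) + 1) ^ r := by gcongr; linarith
            _ ≤ _ := by
                apply pow_le_pow_right₀
                · linarith [show (0 : ℝ) ≤ k by positivity]
                · omega
        rw [norm_mul, Complex.norm_natCast]
        calc (k.descFactorial r : ℝ) * ‖PowerSeries.coeff (r + j) (b r)‖ * gam s k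
            ≤ (((k : ℝ) + 1) ^ (r - p) * ((k : ℝ) + 1) ^ p) *
              (A * B ^ (r + j) * (C2 r * 2 ^ j * gam s j)) * gam s k := by
              gcongr
              refine (h.gevrey r (r + j)).trans ?_
              gcongr
              exact h2 r j
          _ = A * B ^ r * C2 r * (2 * B) ^ j * ((k : ℝ) + 1) ^ p *
              (gam s k * gam s j * ((k : ℝ) + 1) ^ (r - p)) := by
              rw [pow_add, mul_pow]; ring
          _ ≤ A * B ^ r * C2 r * (2 * B) ^ j * ((k : ℝ) + 1) ^ p *
              (C1 (r - p) * gam s (k + j)) :=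
              mul_le_mul_of_nonneg_left (h1 _ k j hq) (by positivity)
          _ = _ := by ring

theorem tendsto_tco (h : SlopeBound s b p A B) (hs : 0 ≤ s) (N j : ℕ) :
    Tendsto (fun k : ℕ => tco s b N j k / (k : ℝ) ^ p) atTop (𝓝 ‖mu s b N p j‖) := by
  have h1 : Tendsto (fun k : ℕ => ∑ r ∈ Finset.range N,
      (((k.descFactorial r : ℝ) * gam s k / gam s (k + j) / (k : ℝ) ^ p : ℝ) : ℂ) *
        PowerSeries.coeff (r + j) (b r)) atTop (𝓝 (mu s b N p j)) := by
    unfold mu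
    refine tendsto_finsetSum _ fun r _ => ?_
    by_cases h0 : PowerSeries.coeff (r + j) (b r) = 0
    · simp [h0]
    · have h2 := (Complex.continuous_ofReal.tendsto _).comp (tendsto_term hs (h.slope r j h0))
      have h3 := h2.mul_const (PowerSeries.coeff (r + j) (b r))
      refine h3.congr' (Eventually.of_forall fun k => rfl) |>.trans (le_of_eq ?_)
      congr 1
      split_ifs <;> simp
  refine h1.norm.congr fun k => ?_
  have gk := gam_pos hs k
  have gkj := gam_pos hs (k + j)
  have e : ∑ r ∈ Finset.range N,
      (((k.descFactorial r : ℝ) * gam s k / gam s (k + j) / (k : ℝ) ^ p : ℝ) : ℂ) *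
        PowerSeries.coeff (r + j) (b r) =
      ((gam s k / gam s (k + j) / (k : ℝ) ^ p : ℝ) : ℂ) * opCoeff b N j k := by
    unfold opCoeff
    rw [Finset.mul_sum]
    refine Finset.sum_congr rfl fun r _ => ?_
    push_cast
    ring
  rw [e, norm_mul, Complex.norm_real, Real.norm_of_nonneg (by positivity)]
  unfold tco
  ring

theorem summable_tco (h : SlopeBound s b p A B) (hs : 0 ≤ s) (hA : 0 ≤ A) (hB : 0 ≤ B) (N : ℕ)
    {R : ℝ} (hR : 0 < R) (hRB : R * (2 * B) < 1) (k : ℕ) :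
    Summable fun j => tco s b N j k * R ^ j := by
  obtain ⟨C, hC, hle⟩ := h.tco_le hs hA hB N
  refine Summable.of_nonneg_of_le (fun j => mul_nonneg (tco_nonneg hs b N j k) (by positivity))
    (fun j => ?_) ((summable_geometric_of_lt_one (by positivity) hRB).mul_left
      (C * ((k : ℝ) + 1) ^ p))
  calc _ ≤ C * (2 * B) ^ j * ((k : ℝ) + 1) ^ p * R ^ j := by
        gcongr
        exact hle k j
    _ = _ := by rw [mul_pow R]; ring

/-- Column k divided by k^p converges to the sequence |mu_j| R^j, with geometric majorant from
`tco_le`. By dominated convergence a strict inequality for the limit passes to all far columns. -/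
theorem eventually_dominant (h : SlopeBound s b p A B) (hs : 0 ≤ s) (hA : 0 ≤ A) (hB : 0 ≤ B)
    (N : ℕ) {R : ℝ} (hR : 0 < R) (hRB : R * (2 * B) < 1) (J : ℕ) {θ : ℝ}
    (hmu : (∑' j, if j = J then 0 else ‖mu s b N p j‖ * R ^ j) < θ * (‖mu s b N p J‖ * R ^ J)) :
    ∃ K, ∀ k, K ≤ k → (∑' j, if j = J then 0 else tco s b N j k * R ^ j) ≤
      θ * (tco s b N J k * R ^ J) := by
  obtain ⟨C, hC, hle⟩ := h.tco_le hs hA hB N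
  have hlim : Tendsto (fun k : ℕ => ∑' j, (if j = J then 0 else tco s b N j k * R ^ j)
      / (k : ℝ) ^ p) atTop (𝓝 (∑' j, if j = J then 0 else ‖mu s b N p j‖ * R ^ j)) := by
    refine tendsto_tsum_of_dominated_convergence
      (bound := fun j => C * 2 ^ p * (R * (2 * B)) ^ j)
      ((summable_geometric_of_lt_one (by positivity) hRB).mul_left _) (fun j => ?_) ?_
    · split_ifs with hj
      · simp
      · refine ((h.tendsto_tco hs N j).mul_const (R ^ j)).congr fun k => ?_
        ring
    · filter_upwards [eventually_gt_atTop 0] with k hk j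
      have hk1 : (1 : ℝ) ≤ k := by exact_mod_cast hk
      have hk0 : (0 : ℝ) < k := by linarith
      split_ifs with hj
      · simp only [zero_div, norm_zero]
        positivity
      · have ht := tco_nonneg hs b N j k
        rw [Real.norm_of_nonneg (by positivity), div_le_iff₀ (by positivity)]
        calc _ ≤ C * (2 * B) ^ j * ((k : ℝ) + 1) ^ p * R ^ j := by
              gcongr
              exact hle k j
          _ ≤ C * (2 * B) ^ j * (2 * (k : ℝ)) ^ p * R ^ j := by
              gcongr
              linarith
          _ = _ := by rw [mul_pow R, mul_pow 2 (k : ℝ)]; ring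
  have hlim2 := ((h.tendsto_tco hs N J).mul_const (R ^ J)).const_mul θ
  obtain ⟨K, hK⟩ := eventually_atTop.1
    ((hlim.eventually_lt hlim2 hmu).and (eventually_gt_atTop 0))
  refine ⟨K, fun k hk => ?_⟩
  obtain ⟨h1, hk0⟩ := hK k hk
  have hk0 : (0 : ℝ) < k := by exact_mod_cast hk0
  rw [tsum_div_const] at h1
  have h2 : θ * (tco s b N J k / (k : ℝ) ^ p * R ^ J)
      = θ * (tco s b N J k * R ^ J) / (k : ℝ) ^ p := by ring
  rw [h2, div_lt_div_iff_of_pos_right (by positivity)] at h1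
  exact h1.le

/-- The coefficient of z^(k+J) in the image, solved for the contribution of column k. -/
theorem diagonal_le (h : SlopeBound s b p A B) (hs : 0 ≤ s) (N : ℕ)
    {R : ℝ} (hR : 0 < R) (u : ℂ⟦X⟧) (J k : ℕ) :
    tco s b N J k * R ^ J * (nco s u k * R ^ k) ≤
      nco s (diffOp b N u) (k + J) * R ^ (k + J) +
        ∑ i ∈ (Finset.range (k + J + 1)).erase k,
          tco s b N (k + J - i) i * R ^ (k + J - i) * (nco s u i * R ^ i) := by
  have hc := coeff_diffOp h.ord N u (k + J)
  rw [← Finset.add_sum_erase _ _ (show k ∈ Finset.range (k + J + 1) by simp),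
    Nat.add_sub_cancel_left, ← sub_eq_iff_eq_add] at hc
  have hg := gam_pos hs (k + J)
  have key : ∀ i ≤ k + J, tco s b N (k + J - i) i * R ^ (k + J - i) * (nco s u i * R ^ i)
      = ‖opCoeff b N (k + J - i) i * PowerSeries.coeff i u‖ * (R ^ (k + J) / gam s (k + J)) := by
    intro i hi
    have gi := gam_pos hs i
    unfold tco nco
    rw [norm_mul, Nat.add_sub_cancel' hi,
      show R ^ (k + J) = R ^ (k + J - i) * R ^ i by rw [← pow_add, Nat.sub_add_cancel hi]]
    field_simp
  have hk := key k (by omega)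
  rw [Nat.add_sub_cancel_left] at hk
  rw [hk, ← hc, Finset.sum_congr rfl fun i hi => key i (by
    rw [Finset.mem_erase, Finset.mem_range] at hi; omega), ← Finset.sum_mul]
  unfold nco
  rw [div_mul_eq_mul_div, ← mul_div_assoc, ← mul_div_assoc, ← add_div, ← add_mul]
  gcongr
  exact (norm_sub_le _ _).trans (add_le_add_right (norm_sum_le _ _) _)

theorem summable_of_diffOp (h : SlopeBound s b p A B) (hs : 0 ≤ s) (hA : 0 ≤ A) (hB : 0 ≤ B)
    {N : ℕ} {R : ℝ} (hR : 0 < R) (hRB : R * (2 * B) < 1)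
    (hmu : (∑' j, if j = 0 then 0 else ‖mu s b N p j‖ * R ^ j) < 1 / 2 * ‖mu s b N p 0‖)
    {c : ℝ} (hc : 0 < c) (hW : ∀ k, c ≤ ‖opCoeff b N 0 k‖) {u : ℂ⟦X⟧}
    (hu : Summable fun k => nco s (diffOp b N u) k * R ^ k) :
    Summable fun k => nco s u k * R ^ k := by
  obtain ⟨K, hK⟩ := h.eventually_dominant hs hA hB N hR hRB 0 (θ := 1 / 2) (by simpa using hmu)
  refine summable_of_diagonal_zero (T := fun k j => tco s b N j k * R ^ j)
    (F := fun k => nco s (diffOp b N u) k * R ^ k)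
    (fun k j => mul_nonneg (tco_nonneg hs b N j k) (by positivity))
    (fun k => mul_nonneg (nco_nonneg hs u k) (by positivity))
    (fun k => mul_nonneg (nco_nonneg hs _ k) (by positivity))
    (h.summable_tco hs hA hB N hR hRB) (fun k => ?_) hu hK hc (fun k => ?_)
  · simpa using h.diagonal_le hs N hR u 0 k
  · have := gam_pos hs k
    simpa [tco, this.ne'] using hW k

/-- Take K beyond which subdiagonal J dominates. By triangularity the preimage of z^K starts in
degree K, and since J ≥ 1 the right side vanishes in all degrees k+J with k ≥ K. The equations are
then homogeneous with a dominant subdiagonal, so a preimage in G_s(ρ) is ruled out by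
`diagonal_eq_zero`. -/
theorem exists_preimage_notMem (h : SlopeBound s b p A B) (hs : 0 ≤ s) (hA : 0 ≤ A) (hB : 0 ≤ B)
    {N : ℕ} {R ρ : ℝ} (hR : 0 < R) (hRρ : R < ρ) (hRB : R * (2 * B) < 1) {J : ℕ} (hJ : 1 ≤ J)
    (hmu : (∑' j, if j = J then 0 else ‖mu s b N p j‖ * R ^ j) <
      1 / 2 * (‖mu s b N p J‖ * R ^ J))
    (hW : ∀ k, opCoeff b N 0 k ≠ 0) :
    ∃ K : ℕ, ∀ u : ℂ⟦X⟧, diffOp b N u = X ^ K → u ∉ gevreyDisc s ρ hs := by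
  obtain ⟨K, hK⟩ := h.eventually_dominant hs hA hB N hR hRB J hmu
  refine ⟨K, fun u hu hmem => ?_⟩
  have hlow : ∀ i < K, PowerSeries.coeff i u = 0 := by
    intro i
    induction i using Nat.strong_induction_on with
    | _ i ih =>
      intro hi
      have hc := coeff_diffOp h.ord N u i
      rw [hu, PowerSeries.coeff_X_pow, if_neg hi.ne, Finset.sum_range_succ,
        Finset.sum_eq_zero fun k hk => by
          rw [ih k (Finset.mem_range.1 hk) ((Finset.mem_range.1 hk).trans hi), mul_zero]] at hc
      simpa [hW] using hc.symm
  have hKne : PowerSeries.coeff K u ≠ 0 := by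
    intro h0
    have hc := coeff_diffOp h.ord N u K
    rw [hu, PowerSeries.coeff_X_pow, if_pos rfl, Finset.sum_range_succ, h0,
      Finset.sum_eq_zero fun k hk => by rw [hlow k (Finset.mem_range.1 hk), mul_zero]] at hc
    simp at hc
  obtain ⟨C, hC, hle⟩ := h.tco_le hs hA hB N
  have hT0 : ∀ k j, 0 ≤ tco s b N j k * R ^ j := fun k j =>
    mul_nonneg (tco_nonneg hs b N j k) (by positivity)
  have hx0 : ∀ k, 0 ≤ nco s u k * R ^ k := fun k =>
    mul_nonneg (nco_nonneg hs u k) (by positivity)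
  have hsum : Summable fun k => tco s b N J k * R ^ J * (nco s u k * R ^ k) := by
    have hs1 := summable_pow_mul_nco hs hmem hR hRρ p
    have hs0 : Summable fun k : ℕ => nco s u k * R ^ k := by
      simpa using summable_pow_mul_nco hs hmem hR hRρ 0
    refine Summable.of_nonneg_of_le (fun k => mul_nonneg (hT0 k J) (hx0 k)) (fun k => ?_)
      (((hs1.add hs0).mul_left (C * (2 * B) ^ J * 2 ^ p * R ^ J)))
    have hp : ((k : ℝ) + 1) ^ p ≤ 2 ^ p * ((k : ℝ) ^ p + 1) := by
      rcases Nat.eq_zero_or_pos k with rfl | hk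
      · have h1 : (1 : ℝ) ≤ 2 ^ p := one_le_pow₀ (by norm_num)
        have h2 : (0 : ℝ) ≤ 2 ^ p * (0 : ℝ) ^ p := by positivity
        simp only [Nat.cast_zero, zero_add, one_pow]
        linarith
      · have hk' : (1 : ℝ) ≤ k := by exact_mod_cast hk
        calc ((k : ℝ) + 1) ^ p ≤ (2 * (k : ℝ)) ^ p := by gcongr; linarith
          _ = 2 ^ p * (k : ℝ) ^ p := mul_pow _ _ _
          _ ≤ _ := by gcongr; linarith
    have hxk := hx0 k
    calc tco s b N J k * R ^ J * (nco s u k * R ^ k)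
        ≤ C * (2 * B) ^ J * (2 ^ p * ((k : ℝ) ^ p + 1)) * R ^ J * (nco s u k * R ^ k) := by
          gcongr
          exact (hle k J).trans (by gcongr)
      _ = _ := by ring
  have hzero := diagonal_eq_zero (T := fun k j => tco s b N j k * R ^ j)
    (x := fun k => nco s u k * R ^ k) (J := J) hT0 hx0
    (h.summable_tco hs hA hB N hR hRB) (fun k => ?_) (by norm_num : (1 : ℝ) / 2 < 1)
    (fun k hk => hK k ?_) hsum K
  · have hxK : nco s u K * R ^ K ≠ 0 := by
      have := gam_pos hs K
      unfold nco
      have := norm_pos_iff.2 hKne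
      positivity
    -- With the entry on subdiagonal J zero, domination makes the whole column K vanish,
    -- contradicting its nonzero diagonal entry.
    have hTJ : tco s b N J K * R ^ J = 0 := (mul_eq_zero.1 hzero).resolve_right hxK
    have hd := hK K le_rfl
    rw [hTJ, mul_zero] at hd
    have hsm : Summable fun j => if j = J then 0 else tco s b N j K * R ^ j := by
      refine Summable.of_nonneg_of_le (fun j => ?_) (fun j => ?_)
        (h.summable_tco hs hA hB N hR hRB K)
      · split_ifs <;> simp [hT0]
      · split_ifs <;> simp [hT0]
    have h0 := hsm.le_tsum 0 fun j _ => by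
      split_ifs <;> simp [hT0]
    rw [if_neg (by omega)] at h0
    have hpos : 0 < tco s b N 0 K * R ^ 0 := by
      have := gam_pos hs K
      have := norm_pos_iff.2 (hW K)
      unfold tco
      simp only [add_zero]
      positivity
    linarith
  · by_cases hk : k < K
    · have : nco s u k = 0 := by simp [nco, hlow k hk]
      simp only [this, zero_mul, mul_zero]
      exact Finset.sum_nonneg fun i _ => mul_nonneg (hT0 i _) (hx0 i)
    · have hd := h.diagonal_le hs N hR u J k
      have h0 : nco s (diffOp b N u) (k + J) = 0 := by
        rw [hu]
        simp only [nco, PowerSeries.coeff_X_pow]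
        rw [if_neg (by omega)]
        simp
      rw [h0, zero_mul, zero_add] at hd
      exact hd
  · by_contra hlt
    exact hk (by simp [nco, hlow k (not_le.1 hlt)])

end SlopeBound

/-! ### Reading off bounds from the Newton polygon -/

theorem corner_subset_newtonPolygon {b : ℕ → ℂ⟦X⟧} {r : ℕ} (hr : b r ≠ 0) :
    corner (r : ℝ) (((b r).order.toNat : ℝ) - (r : ℝ)) ⊆ newtonPolygon b :=
  (Set.subset_biUnion_of_mem (u := fun r : ℕ =>
    corner (r : ℝ) (((b r).order.toNat : ℝ) - (r : ℝ))) (show r ∈ {r : ℕ | b r ≠ 0} from hr)).trans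
    (subset_convexHull ℝ _)

theorem newtonPolygon_subset {b : ℕ → ℂ⟦X⟧} {H : Set (ℝ × ℝ)} (hH : Convex ℝ H)
    (h : ∀ r, b r ≠ 0 → corner (r : ℝ) (((b r).order.toNat : ℝ) - (r : ℝ)) ⊆ H) :
    newtonPolygon b ⊆ H :=
  convexHull_min (Set.iUnion₂_subset fun r hr => h r hr) hH

theorem le_order_of_isLowerOrdinate {b : ℕ → ℂ⟦X⟧} (h : IsLowerOrdinate (newtonPolygon b) 0)
    {r : ℕ} (hr : b r ≠ 0) : r ≤ (b r).order.toNat := by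
  have := h.2 ⟨((r : ℝ), ((b r).order.toNat : ℝ) - (r : ℝ)),
    corner_subset_newtonPolygon hr ⟨le_rfl, le_rfl⟩, rfl⟩
  have h2 : (r : ℝ) ≤ ((b r).order.toNat : ℝ) := by
    simp only at this
    linarith
  exact_mod_cast h2

theorem coeff_eq_zero_of_isLowerOrdinate {b : ℕ → ℂ⟦X⟧}
    (h : IsLowerOrdinate (newtonPolygon b) 0) (r i : ℕ) (hi : i < r) :
    PowerSeries.coeff i (b r) = 0 := by
  by_cases hr : b r = 0
  · simp [hr]
  · exact PowerSeries.coeff_of_lt_order_toNat i (hi.trans_le (le_order_of_isLowerOrdinate h hr))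

/-- Otherwise every order exceeds r by at least 1, so all corners, and with them their convex hull,
lie in y ≥ 1. -/
theorem exists_coeff_ne_zero_of_isLowerOrdinate {b : ℕ → ℂ⟦X⟧}
    (h : IsLowerOrdinate (newtonPolygon b) 0) : ∃ r, PowerSeries.coeff r (b r) ≠ 0 := by
  by_contra! hc
  have hsub : newtonPolygon b ⊆ {P : ℝ × ℝ | 1 ≤ P.2} := by
    refine newtonPolygon_subset ?_ fun r hr P hP => ?_
    · exact convex_halfSpace_ge (f := fun P : ℝ × ℝ => P.2) ⟨fun _ _ => rfl, fun _ _ => rfl⟩ 1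
    · have h1 := le_order_of_isLowerOrdinate h hr
      have h2 : (b r).order.toNat ≠ r := by
        intro he
        have := PowerSeries.coeff_order hr
        rw [he] at this
        exact this (hc r)
      have h3 : (r : ℝ) + 1 ≤ ((b r).order.toNat : ℝ) := by
        exact_mod_cast Nat.lt_of_le_of_ne h1 (Ne.symm h2)
      have h4 := hP.2
      simp only [Set.mem_ofPred_eq]
      linarith
  obtain ⟨P, hP, hP0⟩ := h.1
  have h1 : (1 : ℝ) ≤ P.2 := hsub hP
  rw [hP0] at h1
  linarith

/-- The point (p, 0) is the right end of the bottom edge. The smallest ratio (ord b_i - i)/(i - p)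
over i > p is the slope of a supporting line through (p, 0) and another corner. It is positive by
maximality of p, so it is at least 1/s, and every corner to the right of p lies on or above that
line. -/
theorem le_add_mul_of_firstPositiveSlope {s : ℝ} (hs : 0 ≤ s) {b : ℕ → ℂ⟦X⟧}
    (ha : IsLowerOrdinate (newtonPolygon b) 0)
    (hb : (ENNReal.ofReal s)⁻¹ ≤ firstPositiveSlope (newtonPolygon b))
    {N : ℕ} (hN : ∀ r, N ≤ r → b r = 0) {p : ℕ} (hp : PowerSeries.coeff p (b p) ≠ 0)
    (hmax : ∀ r, p < r → PowerSeries.coeff r (b r) = 0) (r j : ℕ)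
    (hrj : PowerSeries.coeff (r + j) (b r) ≠ 0) : (r : ℝ) ≤ p + s * j := by
  classical
  rcases le_or_gt r p with hle | hlt
  · have : (r : ℝ) ≤ p := by exact_mod_cast hle
    have : 0 ≤ s * j := by positivity
    linarith
  have hbp : b p ≠ 0 := by
    rintro h0
    simp [h0] at hp
  have hbr : b r ≠ 0 := by
    rintro h0
    simp [h0] at hrj
  have hordp : (b p).order.toNat = p := by
    refine le_antisymm ?_ (le_order_of_isLowerOrdinate ha hbp)
    by_contra hc
    exact hp (PowerSeries.coeff_of_lt_order_toNat p (not_le.1 hc))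
  have hordr : (b r).order.toNat ≤ r + j := by
    by_contra hc
    exact hrj (PowerSeries.coeff_of_lt_order_toNat _ (not_le.1 hc))
  let F := (Finset.range N).filter fun i => p < i ∧ b i ≠ 0
  have hF : ∀ i, i ∈ F ↔ p < i ∧ b i ≠ 0 := by
    intro i
    simp only [F, Finset.mem_filter, Finset.mem_range, and_iff_right_iff_imp]
    rintro ⟨-, hi⟩
    by_contra hc
    exact hi (hN i (not_lt.1 hc))
  let κ : ℕ → ℝ := fun i => (((b i).order.toNat : ℝ) - i) / ((i : ℝ) - p)
  obtain ⟨i0, hi0, hmin⟩ := F.exists_min_image κ ⟨r, (hF r).2 ⟨hlt, hbr⟩⟩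
  obtain ⟨hpi0, hbi0⟩ := (hF i0).1 hi0
  have hden : ∀ i, p < i → (0 : ℝ) < (i : ℝ) - p := fun i hi => by
    have : (p : ℝ) < i := by exact_mod_cast hi
    linarith
  have hκpos : 0 < κ i0 := by
    refine div_pos ?_ (hden i0 hpi0)
    have h1 := le_order_of_isLowerOrdinate ha hbi0
    have h2 : (b i0).order.toNat ≠ i0 := by
      intro he
      have := PowerSeries.coeff_order hbi0
      rw [he] at this
      exact this (hmax i0 hpi0)
    have : (i0 : ℝ) < ((b i0).order.toNat : ℝ) := by
      exact_mod_cast Nat.lt_of_le_of_ne h1 (Ne.symm h2)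
    linarith
  have hslope : IsSlope (newtonPolygon b) (κ i0) := by
    refine ⟨-(κ i0 * p), ?_, ?_⟩
    · have hsub : newtonPolygon b ⊆ {P : ℝ × ℝ | -(κ i0 * p) ≤ P.2 - κ i0 * P.1} := by
        refine newtonPolygon_subset ?_ fun i hi P hP => ?_
        · refine convex_halfSpace_ge (f := fun P : ℝ × ℝ => P.2 - κ i0 * P.1)
            ⟨fun x y => ?_, fun c x => ?_⟩ _
          · simp only [Prod.fst_add, Prod.snd_add]
            ring
          · simp only [Prod.smul_fst, Prod.smul_snd, smul_eq_mul]
            ring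
        · obtain ⟨hP1, hP2⟩ := hP
          simp only [Set.mem_ofPred_eq]
          have hPi : κ i0 * P.1 ≤ κ i0 * i := by gcongr
          have hoi : (i : ℝ) ≤ ((b i).order.toNat : ℝ) := by
            exact_mod_cast le_order_of_isLowerOrdinate ha hi
          rcases le_or_gt i p with hip | hip
          · have : κ i0 * i ≤ κ i0 * p := by gcongr
            linarith
          · have h1 := hmin i ((hF i).2 ⟨hip, hi⟩)
            have h2 := (le_div_iff₀ (hden i hip)).1 h1
            nlinarith
      intro P hP
      have : -(κ i0 * p) ≤ P.2 - κ i0 * P.1 := hsub hP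
      linarith
    · refine ⟨((p : ℝ), 0), ⟨?_, ?_⟩, ((i0 : ℝ), ((b i0).order.toNat : ℝ) - i0), ⟨?_, ?_⟩, ?_⟩
      · refine corner_subset_newtonPolygon hbp ⟨le_rfl, ?_⟩
        simp [hordp]
      · simp
      · exact corner_subset_newtonPolygon hbi0 ⟨le_rfl, le_rfl⟩
      · have := hden i0 hpi0
        simp only [κ]
        field_simp
        ring
      · intro he
        have := congrArg Prod.fst he
        have := hden i0 hpi0
        simp only at *
        linarith
  have h1 : (ENNReal.ofReal s)⁻¹ ≤ ENNReal.ofReal (κ i0) :=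
    hb.trans (sInf_le ⟨κ i0, hκpos, hslope, rfl⟩)
  -- For s = 0 the bound reads ∞ ≤ κ, so no corner to the right of p exists.
  have h2 : 1 ≤ s * κ i0 := by
    rcases hs.eq_or_lt with rfl | hs'
    · simp at h1
    · rw [← ENNReal.ofReal_inv_of_pos hs', ENNReal.ofReal_le_ofReal_iff hκpos.le,
        inv_le_iff_one_le_mul₀ hs'] at h1
      linarith
  have h3 : κ i0 ≤ (j : ℝ) / ((r : ℝ) - p) := by
    refine (hmin r ((hF r).2 ⟨hlt, hbr⟩)).trans ?_
    have := hden r hlt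
    have hor : ((b r).order.toNat : ℝ) ≤ r + j := by exact_mod_cast hordr
    simp only [κ]
    gcongr
    linarith
  have h4 : κ i0 * ((r : ℝ) - p) ≤ j := (le_div_iff₀ (hden r hlt)).1 h3
  nlinarith [hden r hlt]

/-! ### Growth of polynomials in `n` -/

theorem tendsto_sum_descFactorial {ι : Type*} (F : Finset ι) (e : ι → ℕ) (x : ι → ℂ) {D : ℕ}
    (h : ∀ d ∈ F, x d ≠ 0 → e d ≤ D) :
    Tendsto (fun n : ℕ => (∑ d ∈ F, (n.descFactorial (e d) : ℂ) * x d) / (n : ℂ) ^ D) atTop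
      (𝓝 (∑ d ∈ F, if e d = D then x d else 0)) := by
  simp only [Finset.sum_div]
  refine tendsto_finsetSum _ fun d hd => ?_
  by_cases hx : x d = 0
  · simp [hx]
  have key : ∀ n : ℕ, (n.descFactorial (e d) : ℂ) * x d / (n : ℂ) ^ D =
      (((n.descFactorial (e d) : ℝ) / (n : ℝ) ^ D : ℝ) : ℂ) * x d := by
    intro n
    push_cast
    ring
  simp only [key]
  split_ifs with he
  · have h1 := tendsto_descFactorial_div_pow (e d)
    rw [he] at h1 ⊢
    have := ((Complex.continuous_ofReal.tendsto _).comp h1).mul_const (x d)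
    simpa using this
  · have h1 := tendsto_descFactorial_div_pow_of_lt (lt_of_le_of_ne (h d hd hx) he)
    have := ((Complex.continuous_ofReal.tendsto _).comp h1).mul_const (x d)
    simpa using this

/-- Falling factorials of distinct degrees cannot cancel: after division by n to the largest degree
that occurs, a single nonzero term survives in the limit. -/
theorem eventually_sum_descFactorial_ne_zero {ι : Type*} (F : Finset ι) {e : ι → ℕ}
    (he : Set.InjOn e F) {x : ι → ℂ} (hx : ∃ d ∈ F, x d ≠ 0) :
    ∀ᶠ n : ℕ in atTop, ∑ d ∈ F, (n.descFactorial (e d) : ℂ) * x d ≠ 0 := by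
  classical
  obtain ⟨d1, hd1, hx1⟩ := hx
  obtain ⟨d0, hd0, hmax⟩ := (F.filter fun d => x d ≠ 0).exists_max_image e
    ⟨d1, Finset.mem_filter.2 ⟨hd1, hx1⟩⟩
  rw [Finset.mem_filter] at hd0
  have hlim := tendsto_sum_descFactorial F e x (D := e d0)
    fun d hd hxd => hmax d (Finset.mem_filter.2 ⟨hd, hxd⟩)
  have hval : ∑ d ∈ F, (if e d = e d0 then x d else 0) = x d0 := by
    rw [Finset.sum_eq_single_of_mem d0 hd0.1 fun d hd hne => if_neg fun h => hne (he hd hd0.1 h),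
      if_pos rfl]
  rw [hval] at hlim
  filter_upwards [hlim.eventually_ne hd0.2] with n hn h0
  rw [h0, zero_div] at hn
  exact hn rfl

/-! ### Smallness on small discs -/

/-- The tail is at most C x₀ RB/(1 - RB), which is below x₀/2 exactly when 2C·RB < 1 - RB, if x₀ >
0; this is `hRB`. -/
theorem tsum_lt_half {x : ℕ → ℝ} {C B R : ℝ} (hx : ∀ j, 0 ≤ x j) (hx0 : 0 < x 0) (hC : 0 ≤ C)
    (hB : 0 ≤ B) (hxB : ∀ j, x j ≤ C * B ^ j * x 0) (hR : 0 < R)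
    (hRB : R * B * (1 + 2 * C) < 1) :
    (∑' j, if j = 0 then 0 else x j * R ^ j) < 1 / 2 * x 0 := by
  have hRB0 : 0 ≤ R * B := by positivity
  have hRB1 : R * B < 1 := by nlinarith
  have hg := (summable_geometric_of_lt_one hRB0 hRB1)
  have hle : ∀ j, x j * R ^ j ≤ C * x 0 * (R * B) ^ j := by
    intro j
    calc _ ≤ C * B ^ j * x 0 * R ^ j := by
          gcongr
          exact hxB j
      _ = _ := by rw [mul_pow]; ring
  have hs : Summable fun j => if j = 0 then 0 else x j * R ^ j := by
    refine Summable.of_nonneg_of_le (fun j => ?_) (fun j => ?_) (hg.mul_left (C * x 0))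
    · split_ifs
      · rfl
      · have := hx j
        positivity
    · split_ifs
      · positivity
      · exact hle j
  rw [hs.tsum_eq_zero_add, if_pos rfl, zero_add]
  have hg1 : Summable fun j : ℕ => C * x 0 * (R * B) * (R * B) ^ j := hg.mul_left _
  have h1 : (∑' j : ℕ, if j + 1 = 0 then 0 else x (j + 1) * R ^ (j + 1)) ≤
      ∑' j : ℕ, C * x 0 * (R * B) * (R * B) ^ j := by
    refine ((summable_nat_add_iff 1).2 hs).tsum_le_tsum (fun j => ?_) hg1
    rw [if_neg (by omega)]
    refine (hle (j + 1)).trans (le_of_eq ?_)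
    rw [pow_succ]
    ring
  refine h1.trans_lt ?_
  rw [tsum_mul_left, tsum_geometric_of_lt_one hRB0 hRB1, ← div_eq_mul_inv,
    div_lt_iff₀ (by linarith)]
  nlinarith

theorem tsum_lt_half_of_least {x : ℕ → ℝ} {J : ℕ} {C B R : ℝ} (hx : ∀ j, 0 ≤ x j)
    (hxJ : 0 < x J) (hlow : ∀ j < J, x j = 0) (hC : 0 ≤ C) (hB : 0 ≤ B)
    (hxB : ∀ j, x j ≤ C * B ^ j) (hR : 0 < R)
    (hRB : R * B * (1 + 2 * (C * B ^ J / x J)) < 1) :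
    (∑' j, if j = J then 0 else x j * R ^ j) < 1 / 2 * (x J * R ^ J) := by
  have hC' : 0 ≤ C * B ^ J / x J := by positivity
  have hRB0 : 0 ≤ R * B := by positivity
  have hRB1 : R * B < 1 := by nlinarith
  have hs : Summable fun j => if j = J then 0 else x j * R ^ j := by
    refine Summable.of_nonneg_of_le (fun j => ?_) (fun j => ?_)
      ((summable_geometric_of_lt_one hRB0 hRB1).mul_left C)
    · split_ifs
      · rfl
      · have := hx j
        positivity
    · split_ifs
      · positivity
      · calc _ ≤ C * B ^ j * R ^ j := by
              gcongr
              exact hxB j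
          _ = _ := by rw [mul_pow]; ring
  have h := tsum_lt_half (x := fun i => x (i + J)) (C := C * B ^ J / x J) (B := B) (R := R)
    (fun i => hx _) (by simpa using hxJ) hC' hB (fun j => by
      simp only [zero_add]
      rw [div_mul_eq_mul_div, div_mul_cancel₀ _ hxJ.ne', mul_assoc, ← pow_add, add_comm J j]
      exact hxB _) hR hRB
  rw [← hs.sum_add_tsum_nat_add J, Finset.sum_eq_zero fun j hj => ?_, zero_add]
  · have he : ∀ i : ℕ, (if i + J = J then 0 else x (i + J) * R ^ (i + J)) =
        (if i = 0 then 0 else x (i + J) * R ^ i) * R ^ J := by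
      intro i
      by_cases hi : i = 0
      · simp [hi]
      · rw [if_neg (by omega), if_neg hi, pow_add]
        ring
    simp only [he]
    rw [tsum_mul_right]
    simp only [zero_add] at h
    have : 0 < R ^ J := by positivity
    nlinarith
  · have hj' := Finset.mem_range.1 hj
    rw [if_neg (by omega), hlow j hj', zero_mul]

theorem SlopeBound.mu_le {s : ℝ} {b : ℕ → ℂ⟦X⟧} {p : ℕ} {A B : ℝ} (h : SlopeBound s b p A B)
    (hs : 0 ≤ s) (hA : 0 ≤ A) (hB : 0 ≤ B) (N : ℕ) :
    ∃ C : ℝ, 0 ≤ C ∧ ∀ j : ℕ, ‖mu s b N p j‖ ≤ C * (2 * B) ^ j := by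
  obtain ⟨C, hC, hle⟩ := h.tco_le hs hA hB N
  refine ⟨C * 2 ^ p, by positivity, fun j => ?_⟩
  refine le_of_tendsto (h.tendsto_tco hs N j) ?_
  filter_upwards [eventually_gt_atTop 0] with k hk
  have hk1 : (1 : ℝ) ≤ k := by exact_mod_cast hk
  have hk0 : (0 : ℝ) < k := by linarith
  rw [div_le_iff₀ (by positivity)]
  calc _ ≤ C * (2 * B) ^ j * ((k : ℝ) + 1) ^ p := hle k j
    _ ≤ C * (2 * B) ^ j * (2 * (k : ℝ)) ^ p := by
        gcongr
        linarith
    _ = _ := by rw [mul_pow 2 (k : ℝ)]; ring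

theorem mu_zero {s : ℝ} {b : ℕ → ℂ⟦X⟧} {N p : ℕ} (hp : p < N) :
    mu s b N p 0 = PowerSeries.coeff p (b p) := by
  unfold mu
  rw [Finset.sum_eq_single_of_mem p (Finset.mem_range.2 hp) fun r _ hr => by
    simp [hr]]
  simp [lam]

/-! ### The family of principal parts -/

section Family

variable {Δ : Finset (ℕ × ℕ)} {a : ℕ × ℕ → ℂ⟦X⟧⟦X⟧} {m : ℕ}

theorem mem_deltaM {d : ℕ × ℕ} :
    d ∈ deltaM Δ a m ↔ d ∈ Δ ∧ (d.1 : ℤ) - (ordT a d : ℤ) = (m : ℤ) := by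
  simp [deltaM]

theorem le_fst_of_mem_deltaM {d : ℕ × ℕ} (hd : d ∈ deltaM Δ a m) : m ≤ d.1 := by
  have := (mem_deltaM.1 hd).2
  omega

theorem ordT_of_mem_deltaM {d : ℕ × ℕ} (hd : d ∈ deltaM Δ a m) : ordT a d = d.1 - m := by
  have := (mem_deltaM.1 hd).2
  omega

theorem leadT_ne_zero (ha0 : ∀ d ∈ Δ, a d ≠ 0) {d : ℕ × ℕ} (hd : d ∈ deltaM Δ a m) :
    leadT a m d ≠ 0 := by
  unfold leadT
  rw [← ordT_of_mem_deltaM hd]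
  exact PowerSeries.coeff_order (ha0 d (mem_deltaM.1 hd).1)

theorem leadZ_ne_zero (ha0 : ∀ d ∈ Δ, a d ≠ 0) {d : ℕ × ℕ} (hd : d ∈ deltaM Δ a m) :
    leadZ a m d ≠ 0 := PowerSeries.coeff_order (leadT_ne_zero ha0 hd)

theorem ordZ_le {d : ℕ × ℕ} {i : ℕ} (h : PowerSeries.coeff i (leadT a m d) ≠ 0) :
    ordZ a m d ≤ i := by
  by_contra hc
  exact h (PowerSeries.coeff_of_lt_order_toNat i (not_le.1 hc))

theorem eq_of_mem_deltaM {d d' : ℕ × ℕ} (hd : d ∈ deltaM Δ a m) (hd' : d' ∈ deltaM Δ a m)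
    (h1 : d.1 - m = d'.1 - m) (h2 : d.2 = d'.2) : d = d' := by
  have := le_fst_of_mem_deltaM hd
  have := le_fst_of_mem_deltaM hd'
  exact Prod.ext (by omega) h2

theorem mem_deltaMJ {d : ℕ × ℕ} {j : ℤ} :
    d ∈ deltaMJ Δ a m j ↔ d ∈ deltaM Δ a m ∧ (ordZ a m d : ℤ) - (d.2 : ℤ) = j := by
  simp [deltaMJ]

/-- A strict bound on the orders in `∂_z` of the terms in `Δ_m`. -/
noncomputable def orderBound (Δ : Finset (ℕ × ℕ)) (a : ℕ × ℕ → ℂ⟦X⟧⟦X⟧) (m : ℕ) : ℕ :=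
  (deltaM Δ a m).sup Prod.snd + 1

theorem snd_lt_orderBound {d : ℕ × ℕ} (hd : d ∈ deltaM Δ a m) : d.2 < orderBound Δ a m :=
  Nat.lt_succ_of_le (Finset.le_sup (f := Prod.snd) hd)

theorem coeff_tildeP (n r i : ℕ) : PowerSeries.coeff i (tildeP Δ a m n r) =
    ∑ d ∈ (deltaM Δ a m).filter (fun d => d.2 = r),
      (n.descFactorial (d.1 - m) : ℂ) * PowerSeries.coeff i (leadT a m d) := by
  simp [tildeP, map_sum]

theorem tildeP_eq_zero {n r : ℕ} (hr : orderBound Δ a m ≤ r) : tildeP Δ a m n r = 0 := by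
  refine Finset.sum_eq_zero fun d hd => ?_
  rw [Finset.mem_filter] at hd
  have := snd_lt_orderBound hd.1
  omega

theorem exists_leadT_of_tildeP {n r i : ℕ}
    (h : PowerSeries.coeff i (tildeP Δ a m n r) ≠ 0) :
    ∃ d ∈ deltaM Δ a m, d.2 = r ∧ PowerSeries.coeff i (leadT a m d) ≠ 0 := by
  rw [coeff_tildeP] at h
  obtain ⟨d, hd, hne⟩ := Finset.exists_ne_zero_of_sum_ne_zero h
  rw [Finset.mem_filter] at hd
  exact ⟨d, hd.1, hd.2, right_ne_zero_of_mul hne⟩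

theorem eventually_coeff_tildeP_ne_zero {d : ℕ × ℕ} {i : ℕ} (hd : d ∈ deltaM Δ a m)
    (h : PowerSeries.coeff i (leadT a m d) ≠ 0) :
    ∀ᶠ n in atTop, PowerSeries.coeff i (tildeP Δ a m n d.2) ≠ 0 := by
  have hinj : Set.InjOn (fun d : ℕ × ℕ => d.1 - m)
      ((deltaM Δ a m).filter (fun d' => d'.2 = d.2) : Finset (ℕ × ℕ)) := by
    intro x hx y hy hxy
    simp only [Finset.coe_filter, Set.mem_ofPred_eq] at hx hy
    exact eq_of_mem_deltaM hx.1 hy.1 hxy (hx.2.trans hy.2.symm)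
  have hev := eventually_sum_descFactorial_ne_zero _ hinj
    (x := fun d => PowerSeries.coeff i (leadT a m d)) ⟨d, Finset.mem_filter.2 ⟨hd, rfl⟩, h⟩
  filter_upwards [hev] with n hn
  rw [coeff_tildeP]
  exact hn

theorem sum_range_orderBound {M : Type*} [AddCommMonoid M] (F : Finset (ℕ × ℕ))
    (hF : F ⊆ deltaM Δ a m) (f : ℕ × ℕ → M) :
    ∑ r ∈ Finset.range (orderBound Δ a m), ∑ d ∈ F.filter (fun d => d.2 = r), f d =
      ∑ d ∈ F, f d :=
  Finset.sum_fiberwise_of_maps_to (fun _ hd =>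
    Finset.mem_range.2 (snd_lt_orderBound (hF hd))) f

/-- The minimum l is defined term by term, whereas the lower ordinate refers to sums over q, which
might cancel. Ordinate 0 gives l ≤ 0. Nonvanishing of W(0,0,0) gives a row r whose coefficient of
z^(r+l) survives the summation, so l ≥ 0. -/
theorem lowerIndex_eq_zero
    (h_a : IsLowerOrdinate (newtonPolygon (tildeP Δ a m 0)) 0) (h_c : bigW Δ a m 0 0 ≠ 0) :
    lowerIndex Δ a m = 0 := by
  set l := lowerIndex Δ a m with hl
  have hfin : ((fun d : ℕ × ℕ => (ordZ a m d : ℤ) - (d.2 : ℤ)) ''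
      (deltaM Δ a m : Set (ℕ × ℕ))).Finite := (Finset.finite_toSet _).image _
  have hmin : ∀ d ∈ deltaM Δ a m, l ≤ (ordZ a m d : ℤ) - (d.2 : ℤ) := fun d hd =>
    csInf_le hfin.bddBelow ⟨d, hd, rfl⟩
  apply le_antisymm
  · obtain ⟨r, hr⟩ := exists_coeff_ne_zero_of_isLowerOrdinate h_a
    obtain ⟨d, hd, hdr, hc⟩ := exists_leadT_of_tildeP hr
    have h1 := ordZ_le hc
    have h2 := hmin d hd
    omega
  · unfold bigW at h_c
    rw [← hl, ← sum_range_orderBound (Δ := Δ) (a := a) (m := m) _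
      (fun d hd => (mem_deltaMJ.1 hd).1)] at h_c
    obtain ⟨r, -, hr⟩ := Finset.exists_ne_zero_of_sum_ne_zero h_c
    obtain ⟨d0, hd0, -⟩ := Finset.exists_ne_zero_of_sum_ne_zero hr
    rw [Finset.mem_filter, mem_deltaMJ] at hd0
    have hcoef : PowerSeries.coeff (ordZ a m d0) (tildeP Δ a m 0 r) ≠ 0 := by
      intro h0
      apply hr
      rw [coeff_tildeP] at h0
      have : ∑ d ∈ (deltaMJ Δ a m l).filter (fun d => d.2 = r),
          leadZ a m d * (Nat.descFactorial 0 (d.1 - m) : ℂ) * (Nat.descFactorial 0 d.2 : ℂ) =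
          (Nat.descFactorial 0 r : ℂ) * ∑ d ∈ (deltaM Δ a m).filter (fun d => d.2 = r),
            (Nat.descFactorial 0 (d.1 - m) : ℂ) *
              PowerSeries.coeff (ordZ a m d0) (leadT a m d) := by
        rw [Finset.mul_sum, deltaMJ, Finset.filter_filter]
        refine (Finset.sum_congr rfl fun d hd => ?_).trans (Finset.sum_subset ?_ ?_)
        · rw [Finset.mem_filter] at hd
          have : ordZ a m d0 = ordZ a m d := by omega
          rw [this, hd.2.2]
          unfold leadZ
          ring
        · intro d hd
          rw [Finset.mem_filter] at hd ⊢
          exact ⟨hd.1, hd.2.2⟩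
        · intro d hd hd'
          rw [Finset.mem_filter] at hd hd'
          have h1 := hmin d hd.1
          have h2 : (ordZ a m d : ℤ) - d.2 ≠ l := fun h => hd' ⟨hd.1, h, hd.2⟩
          have h3 : ordZ a m d0 < ordZ a m d := by omega
          rw [PowerSeries.coeff_of_lt_order_toNat _ h3]
          simp
      rw [this, h0, mul_zero]
    have : r ≤ ordZ a m d0 := by
      by_contra hc
      exact hcoef (coeff_eq_zero_of_isLowerOrdinate h_a r _ (not_le.1 hc))
    omega

theorem le_ordZ (hl : lowerIndex Δ a m = 0) {d : ℕ × ℕ} (hd : d ∈ deltaM Δ a m) :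
    d.2 ≤ ordZ a m d := by
  have hfin : ((fun d : ℕ × ℕ => (ordZ a m d : ℤ) - (d.2 : ℤ)) ''
      (deltaM Δ a m : Set (ℕ × ℕ))).Finite := (Finset.finite_toSet _).image _
  have h : lowerIndex Δ a m ≤ (ordZ a m d : ℤ) - (d.2 : ℤ) :=
    csInf_le hfin.bddBelow ⟨d, hd, rfl⟩
  omega

theorem deltaMJ_zero_nonempty (hne : (deltaM Δ a m).Nonempty) (hl : lowerIndex Δ a m = 0) :
    (deltaMJ Δ a m 0).Nonempty := by
  have h := Int.csInf_mem (s := (fun d : ℕ × ℕ => (ordZ a m d : ℤ) - (d.2 : ℤ)) ''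
      (deltaM Δ a m : Set (ℕ × ℕ))) (hne.to_set.image _)
    ((Finset.finite_toSet _).image _).bddBelow
  obtain ⟨d, hd, he⟩ := h
  exact ⟨d, mem_deltaMJ.2 ⟨hd, he.trans hl⟩⟩

theorem opCoeff_tildeP (hl : lowerIndex Δ a m = 0) (n k : ℕ) :
    opCoeff (tildeP Δ a m n) (orderBound Δ a m) 0 k = bigW Δ a m n k := by
  unfold bigW opCoeff
  rw [hl, deltaMJ, Finset.sum_filter, ← sum_range_orderBound (Δ := Δ) (a := a) (m := m) _
    subset_rfl]
  refine Finset.sum_congr rfl fun r _ => ?_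
  rw [coeff_tildeP, Finset.mul_sum]
  refine Finset.sum_congr rfl fun d hd => ?_
  rw [Finset.mem_filter] at hd
  have h1 := le_ordZ hl hd.1
  rw [← hd.2, add_zero]
  split_ifs with h
  · have : ordZ a m d = d.2 := by omega
    unfold leadZ
    rw [this]
    ring
  · rw [PowerSeries.coeff_of_lt_order_toNat d.2 (show d.2 < ordZ a m d by omega)]
    simp

theorem mem_deltaMJ_zero (hl : lowerIndex Δ a m = 0) {d : ℕ × ℕ} (hd : d ∈ deltaM Δ a m)
    (hc : PowerSeries.coeff d.2 (leadT a m d) ≠ 0) : d ∈ deltaMJ Δ a m 0 := by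
  have h1 := le_ordZ hl hd
  have h2 := ordZ_le hc
  exact mem_deltaMJ.2 ⟨hd, by omega⟩

theorem coeff_leadT_of_mem_deltaMJ (ha0 : ∀ d ∈ Δ, a d ≠ 0) {d : ℕ × ℕ} {j : ℕ}
    (hd : d ∈ deltaMJ Δ a m j) : PowerSeries.coeff (d.2 + j) (leadT a m d) ≠ 0 := by
  have h1 := (mem_deltaMJ.1 hd).2
  have h2 := leadZ_ne_zero ha0 (mem_deltaMJ.1 hd).1
  unfold leadZ at h2
  rwa [show ordZ a m d = d.2 + j by omega] at h2

theorem exists_pIndex (hne : (deltaM Δ a m).Nonempty) (hl : lowerIndex Δ a m = 0) :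
    ∃ d ∈ deltaMJ Δ a m 0, d.2 = pIndex Δ a m := by
  obtain ⟨d, hd, he⟩ := Finset.exists_mem_eq_sup _ (deltaMJ_zero_nonempty hne hl) Prod.snd
  exact ⟨d, hd, he.symm⟩

theorem coeff_tildeP_of_pIndex_lt (hl : lowerIndex Δ a m = 0) (n : ℕ) {r : ℕ}
    (hr : pIndex Δ a m < r) : PowerSeries.coeff r (tildeP Δ a m n r) = 0 := by
  by_contra hc
  obtain ⟨d, hd, hdr, hcd⟩ := exists_leadT_of_tildeP hc
  rw [← hdr] at hcd
  have : d.2 ≤ pIndex Δ a m :=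
    Finset.le_sup (f := Prod.snd) (mem_deltaMJ_zero hl hd hcd)
  omega

theorem exists_gevrey_leadT {s r : ℝ} (hs : 0 ≤ s)
    (haG : ∀ d ∈ Δ, ∀ n : ℕ, PowerSeries.coeff n (a d) ∈ gevreyDisc s r hs) :
    ∃ A B : ℝ, 0 < A ∧ 0 < B ∧ ∀ d ∈ deltaM Δ a m, ∀ i,
      ‖PowerSeries.coeff i (leadT a m d)‖ ≤ A * B ^ i * gam s i := by
  have h : ∀ d ∈ deltaM Δ a m, IsGevrey s (leadT a m d) := fun d hd =>
    (haG d (mem_deltaM.1 hd).1 _).1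
  choose! A B hA hB hAB using h
  refine ⟨∑ d ∈ deltaM Δ a m, A d + 1, ∑ d ∈ deltaM Δ a m, B d + 1,
    add_pos_of_nonneg_of_pos (Finset.sum_nonneg fun d hd => (hA d hd).le) one_pos,
    add_pos_of_nonneg_of_pos (Finset.sum_nonneg fun d hd => (hB d hd).le) one_pos,
    fun d hd i => (hAB d hd i).trans ?_⟩
  have h1 : A d ≤ ∑ d ∈ deltaM Δ a m, A d + 1 := by
    have := Finset.single_le_sum (fun d hd => (hA d hd).le) hd
    linarith
  have h2 : B d ≤ ∑ d ∈ deltaM Δ a m, B d + 1 := by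
    have := Finset.single_le_sum (fun d hd => (hB d hd).le) hd
    linarith
  have hg := (gam_pos hs i).le
  have hA' := hA d hd
  have hB' := hB d hd
  have hA0 : 0 ≤ ∑ d ∈ deltaM Δ a m, A d + 1 := hA'.le.trans h1
  change _ * gam s i ≤ _
  gcongr

/-! ### Slope bounds for the whole family and limits as n → ∞ -/

variable {s A B : ℝ}

/-- Only A' depends on n; the rate B, which enters the choice of radius, does not. -/
theorem slopeBound_tildeP (hs : 0 ≤ s) (hA : 0 < A)
    (hG : ∀ d ∈ deltaM Δ a m, ∀ i,
      ‖PowerSeries.coeff i (leadT a m d)‖ ≤ A * B ^ i * gam s i) {n : ℕ}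
    (h_a : IsLowerOrdinate (newtonPolygon (tildeP Δ a m n)) 0)
    (h_b : (ENNReal.ofReal s)⁻¹ ≤ firstPositiveSlope (newtonPolygon (tildeP Δ a m n)))
    {p : ℕ} (hp : PowerSeries.coeff p (tildeP Δ a m n p) ≠ 0)
    (hmax : ∀ r, p < r → PowerSeries.coeff r (tildeP Δ a m n r) = 0) :
    ∃ A' : ℝ, 0 ≤ A' ∧ SlopeBound s (tildeP Δ a m n) p A' B := by
  refine ⟨∑ d ∈ deltaM Δ a m, (n.descFactorial (d.1 - m) : ℝ) * A,
    Finset.sum_nonneg fun d _ => by positivity,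
    coeff_eq_zero_of_isLowerOrdinate h_a, fun r j h =>
      le_add_mul_of_firstPositiveSlope hs h_a h_b (fun r => tildeP_eq_zero) hp hmax r j h,
    fun r i => ?_⟩
  have hg := gam_pos hs i
  rw [coeff_tildeP, Finset.sum_mul, Finset.sum_mul]
  refine (norm_sum_le _ _).trans ?_
  refine (Finset.sum_le_sum_of_subset_of_nonneg (Finset.filter_subset _ _)
    fun d _ _ => norm_nonneg _).trans (Finset.sum_le_sum fun d hd => ?_)
  rw [norm_mul, Complex.norm_natCast, mul_assoc, mul_assoc, ← mul_assoc A]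
  gcongr
  exact hG d hd i

/-- For an individual n the vertex abscissa p may differ from `pIndex`, since polynomials in n can
vanish at that n. -/
theorem exists_slopeBound_tildeP (hs : 0 ≤ s) (hA : 0 < A)
    (hG : ∀ d ∈ deltaM Δ a m, ∀ i,
      ‖PowerSeries.coeff i (leadT a m d)‖ ≤ A * B ^ i * gam s i) {n : ℕ}
    (h_a : IsLowerOrdinate (newtonPolygon (tildeP Δ a m n)) 0)
    (h_b : (ENNReal.ofReal s)⁻¹ ≤ firstPositiveSlope (newtonPolygon (tildeP Δ a m n))) :
    ∃ p, p < orderBound Δ a m ∧ PowerSeries.coeff p (tildeP Δ a m n p) ≠ 0 ∧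
      ∃ A' : ℝ, 0 ≤ A' ∧ SlopeBound s (tildeP Δ a m n) p A' B := by
  classical
  have hlt : ∀ r, PowerSeries.coeff r (tildeP Δ a m n r) ≠ 0 → r < orderBound Δ a m := by
    intro r hr
    by_contra hc
    rw [tildeP_eq_zero (not_lt.1 hc)] at hr
    simp at hr
  obtain ⟨r0, hr0⟩ := exists_coeff_ne_zero_of_isLowerOrdinate h_a
  obtain ⟨p, hp, hmax⟩ := ((Finset.range (orderBound Δ a m)).filter fun r =>
    PowerSeries.coeff r (tildeP Δ a m n r) ≠ 0).exists_max_image id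
    ⟨r0, Finset.mem_filter.2 ⟨Finset.mem_range.2 (hlt r0 hr0), hr0⟩⟩
  rw [Finset.mem_filter, Finset.mem_range] at hp
  refine ⟨p, hp.1, hp.2, slopeBound_tildeP hs hA hG h_a h_b hp.2 fun r hr => ?_⟩
  by_contra hc
  have : r ≤ p := hmax r (Finset.mem_filter.2 ⟨Finset.mem_range.2 (hlt r hc), hc⟩)
  omega

theorem eventually_slopeBound_tildeP (hs : 0 ≤ s) (hA : 0 < A)
    (hG : ∀ d ∈ deltaM Δ a m, ∀ i,
      ‖PowerSeries.coeff i (leadT a m d)‖ ≤ A * B ^ i * gam s i)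
    (ha0 : ∀ d ∈ Δ, a d ≠ 0) (hne : (deltaM Δ a m).Nonempty) (hl : lowerIndex Δ a m = 0)
    (h_a : ∀ n, IsLowerOrdinate (newtonPolygon (tildeP Δ a m n)) 0)
    (h_b : ∀ n, (ENNReal.ofReal s)⁻¹ ≤ firstPositiveSlope (newtonPolygon (tildeP Δ a m n))) :
    ∀ᶠ n in atTop,
      PowerSeries.coeff (pIndex Δ a m) (tildeP Δ a m n (pIndex Δ a m)) ≠ 0 ∧
      ∃ A' : ℝ, 0 ≤ A' ∧ SlopeBound s (tildeP Δ a m n) (pIndex Δ a m) A' B := by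
  obtain ⟨d, hd, hdp⟩ := exists_pIndex hne hl
  have h1 := eventually_coeff_tildeP_ne_zero (mem_deltaMJ.1 hd).1
    (by simpa using coeff_leadT_of_mem_deltaMJ (j := 0) ha0 (by simpa using hd))
  filter_upwards [h1] with n hn
  rw [hdp] at hn
  exact ⟨hn, slopeBound_tildeP hs hA hG (h_a n) (h_b n) hn fun r hr =>
    coeff_tildeP_of_pIndex_lt hl n hr⟩

/-- The contribution of `(q, r) ∈ Δ_m` to `mu` on the `j`-th subdiagonal, without the factor
depending on `n`. -/
noncomputable def muTerm (s : ℝ) (a : ℕ × ℕ → ℂ⟦X⟧⟦X⟧) (m p : ℕ) (d : ℕ × ℕ) (j : ℕ) : ℂ :=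
  if (d.2 : ℝ) = p + s * j then
    (lam s j : ℂ) * PowerSeries.coeff (d.2 + j) (leadT a m d) else 0

theorem muTerm_ne_zero_iff (hs : 0 ≤ s) {p j : ℕ} {d : ℕ × ℕ} : muTerm s a m p d j ≠ 0 ↔
    (d.2 : ℝ) = p + s * j ∧ PowerSeries.coeff (d.2 + j) (leadT a m d) ≠ 0 := by
  have := (lam_pos hs j).ne'
  unfold muTerm
  split_ifs with h <;> simp [h, this]

theorem mu_tildeP (n p j : ℕ) : mu s (tildeP Δ a m n) (orderBound Δ a m) p j =
    ∑ d ∈ deltaM Δ a m, (n.descFactorial (d.1 - m) : ℂ) * muTerm s a m p d j := by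
  rw [← sum_range_orderBound (Δ := Δ) (a := a) (m := m) _ subset_rfl]
  unfold mu
  refine Finset.sum_congr rfl fun r _ => ?_
  rw [coeff_tildeP, Finset.mul_sum]
  split_ifs with h
  · refine Finset.sum_congr rfl fun d hd => ?_
    have hdr := (Finset.mem_filter.1 hd).2
    rw [muTerm, hdr, if_pos h]
    ring
  · refine (Finset.sum_eq_zero fun d hd => ?_).symm
    have hdr := (Finset.mem_filter.1 hd).2
    rw [muTerm, hdr, if_neg h, mul_zero]

section Generic

variable (hs : 0 ≤ s) (hA : 0 < A) (hB : 0 < B)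
    (hG : ∀ d ∈ deltaM Δ a m, ∀ i,
      ‖PowerSeries.coeff i (leadT a m d)‖ ≤ A * B ^ i * gam s i)
    (hl : lowerIndex Δ a m = 0)

/-- A slope bound for the sums over q passes to the single coefficients, because for large n a
nonzero coefficient is not cancelled. -/
theorem slope_leadT
    (hev : ∀ᶠ n in atTop, ∃ A' : ℝ, SlopeBound s (tildeP Δ a m n) (pIndex Δ a m) A' B)
    {d : ℕ × ℕ} (hd : d ∈ deltaM Δ a m) {j : ℕ}
    (hc : PowerSeries.coeff (d.2 + j) (leadT a m d) ≠ 0) :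
    (d.2 : ℝ) ≤ pIndex Δ a m + s * j := by
  obtain ⟨n, h1, A', h2⟩ := ((eventually_coeff_tildeP_ne_zero hd hc).and hev).exists
  exact h2.slope _ _ h1

include hs hA hB hG hl in
-- Each `muTerm` is the `mu` of the one-term operator a_{q,r,q-m} ∂_z^r, to which `SlopeBound.mu_le`
-- applies.
theorem muTerm_le {p : ℕ}
    (hslope : ∀ d ∈ deltaM Δ a m, ∀ j, PowerSeries.coeff (d.2 + j) (leadT a m d) ≠ 0 →
      (d.2 : ℝ) ≤ p + s * j) :
    ∃ C : ℝ, 0 ≤ C ∧ ∀ j : ℕ, ∑ d ∈ deltaM Δ a m, ‖muTerm s a m p d j‖ ≤ C * (2 * B) ^ j := by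
  have h : ∀ d ∈ deltaM Δ a m, ∃ C : ℝ, 0 ≤ C ∧ ∀ j, ‖muTerm s a m p d j‖ ≤ C * (2 * B) ^ j := by
    intro d hd
    let b : ℕ → ℂ⟦X⟧ := fun r => if r = d.2 then leadT a m d else 0
    have hb : SlopeBound s b p A B := by
      refine ⟨fun r i hi => ?_, fun r j hrj => ?_, fun r i => ?_⟩
      · simp only [b]
        split_ifs with h
        · subst h
          exact PowerSeries.coeff_of_lt_order_toNat i (hi.trans_le (le_ordZ hl hd))
        · simp
      · simp only [b] at hrj
        split_ifs at hrj with h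
        · subst h
          exact hslope d hd j hrj
        · simp at hrj
      · simp only [b]
        split_ifs with h
        · exact hG d hd i
        · have := gam_pos hs i
          simp only [map_zero, norm_zero]
          positivity
    obtain ⟨C, hC, hle⟩ := hb.mu_le hs hA.le hB.le (d.2 + 1)
    refine ⟨C, hC, fun j => (le_of_eq ?_).trans (hle j)⟩
    congr 1
    unfold mu muTerm
    rw [Finset.sum_eq_single_of_mem d.2 (by simp) fun r _ hr => by simp [b, hr]]
    simp [b]
  choose! C hC hle using h
  refine ⟨∑ d ∈ deltaM Δ a m, C d, Finset.sum_nonneg hC, fun j => ?_⟩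
  rw [Finset.sum_mul]
  exact Finset.sum_le_sum fun d hd => hle d hd j

end Generic

theorem norm_mu_tildeP_le {p j D n : ℕ} (hn : 1 ≤ n)
    (hD : ∀ d ∈ deltaM Δ a m, muTerm s a m p d j ≠ 0 → d.1 - m ≤ D) :
    ‖mu s (tildeP Δ a m n) (orderBound Δ a m) p j‖ ≤
      (n : ℝ) ^ D * ∑ d ∈ deltaM Δ a m, ‖muTerm s a m p d j‖ := by
  rw [mu_tildeP, Finset.mul_sum]
  refine (norm_sum_le _ _).trans (Finset.sum_le_sum fun d hd => ?_)
  by_cases h : muTerm s a m p d j = 0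
  · simp [h]
  rw [norm_mul, Complex.norm_natCast]
  gcongr
  calc (n.descFactorial (d.1 - m) : ℝ) ≤ (n : ℝ) ^ (d.1 - m) := by
        exact_mod_cast Nat.descFactorial_le_pow _ _
    _ ≤ _ := pow_le_pow_right₀ (by exact_mod_cast hn) (hD d hd h)

/-- For given j and D a nonzero term has r = p + js and q = D + m. The coefficient of n^D thus comes
from one pair and cannot cancel. -/
theorem sum_muTerm_eq (hs : 0 ≤ s) {p j D : ℕ} {d : ℕ × ℕ} (hd : d ∈ deltaM Δ a m)
    (hdD : d.1 - m = D) (hne : muTerm s a m p d j ≠ 0) :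
    (∑ d' ∈ deltaM Δ a m, if d'.1 - m = D then muTerm s a m p d' j else 0) =
      muTerm s a m p d j := by
  rw [Finset.sum_eq_single_of_mem d hd fun d' hd' hdd => ?_, if_pos hdD]
  split_ifs with h
  · by_contra hc
    have h1 := ((muTerm_ne_zero_iff hs).1 hc).1
    have h2 := ((muTerm_ne_zero_iff hs).1 hne).1
    have h3 : d'.2 = d.2 := by exact_mod_cast h1.trans h2.symm
    exact hdd (eq_of_mem_deltaM hd' hd (h.trans hdD.symm) h3)
  · rfl

/-- The normalised entries of the principal part are dominated by the leading one, uniformly. -/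
def SmallRatio (s : ℝ) (Δ : Finset (ℕ × ℕ)) (a : ℕ × ℕ → ℂ⟦X⟧⟦X⟧) (m n : ℕ) (B C : ℝ) : Prop :=
  ∃ p : ℕ, (∃ A' : ℝ, 0 ≤ A' ∧ SlopeBound s (tildeP Δ a m n) p A' B) ∧
    0 < ‖mu s (tildeP Δ a m n) (orderBound Δ a m) p 0‖ ∧
    ∀ j, ‖mu s (tildeP Δ a m n) (orderBound Δ a m) p j‖ ≤
      C * (2 * B) ^ j * ‖mu s (tildeP Δ a m n) (orderBound Δ a m) p 0‖

/-- Under the degree condition all mu_j grow at most like n^D with D = deg w_{p0}, while mu_0 has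
degree exactly D. This gives a uniform ratio for large n; the finitely many remaining n are treated
singly, each with its own p. -/
theorem exists_smallRatio (hs : 0 ≤ s) (hA : 0 < A) (hB : 0 < B)
    (hG : ∀ d ∈ deltaM Δ a m, ∀ i,
      ‖PowerSeries.coeff i (leadT a m d)‖ ≤ A * B ^ i * gam s i)
    (ha0 : ∀ d ∈ Δ, a d ≠ 0) (hne : (deltaM Δ a m).Nonempty) (hl : lowerIndex Δ a m = 0)
    (h_a : ∀ n, IsLowerOrdinate (newtonPolygon (tildeP Δ a m n)) 0)
    (h_b : ∀ n, (ENNReal.ofReal s)⁻¹ ≤ firstPositiveSlope (newtonPolygon (tildeP Δ a m n)))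
    (hdeg : ∀ j k : ℕ, (k : ℝ) = (j : ℝ) * s →
      degW Δ a m (pIndex Δ a m + k) j ≤ degW Δ a m (pIndex Δ a m) 0) :
    ∃ C : ℝ, 0 ≤ C ∧ ∀ n, SmallRatio s Δ a m n B C := by
  have hmono : ∀ {n : ℕ} {C C' : ℝ}, C ≤ C' → SmallRatio s Δ a m n B C →
      SmallRatio s Δ a m n B C' := by
    rintro n C C' hCC ⟨p, h1, h2, h3⟩
    refine ⟨p, h1, h2, fun j => (h3 j).trans ?_⟩
    gcongr
  have hsingle : ∀ n, ∃ C : ℝ, 0 ≤ C ∧ SmallRatio s Δ a m n B C := by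
    intro n
    obtain ⟨p, hpN, hp, A', hA', hb⟩ := exists_slopeBound_tildeP hs hA hG (h_a n) (h_b n)
    obtain ⟨C, hC, hle⟩ := hb.mu_le hs hA' hB.le (orderBound Δ a m)
    have h0 : 0 < ‖mu s (tildeP Δ a m n) (orderBound Δ a m) p 0‖ := by
      rw [mu_zero hpN]
      exact norm_pos_iff.2 hp
    refine ⟨C / ‖mu s (tildeP Δ a m n) (orderBound Δ a m) p 0‖, by positivity, p, ⟨A', hA', hb⟩,
      h0, fun j => (hle j).trans (le_of_eq ?_)⟩
    field_simp
  have hev := eventually_slopeBound_tildeP hs hA hG ha0 hne hl h_a h_b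
  have hslope : ∀ d ∈ deltaM Δ a m, ∀ j, PowerSeries.coeff (d.2 + j) (leadT a m d) ≠ 0 →
      (d.2 : ℝ) ≤ pIndex Δ a m + s * j := fun d hd j hc =>
    slope_leadT (hev.mono fun n hn => ⟨hn.2.choose, hn.2.choose_spec.2⟩) hd hc
  set p := pIndex Δ a m with hp
  set D := degW Δ a m p 0 with hD
  have hDle : ∀ d ∈ deltaM Δ a m, ∀ j, muTerm s a m p d j ≠ 0 → d.1 - m ≤ D := by
    intro d hd j hne'
    obtain ⟨h1, h2⟩ := (muTerm_ne_zero_iff hs).1 hne'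
    have h3 := ordZ_le h2
    have h4 := le_ordZ hl hd
    obtain ⟨j', hj'⟩ := Nat.exists_eq_add_of_le h4
    have hmem : d ∈ deltaMJ Δ a m j' := mem_deltaMJ.2 ⟨hd, by omega⟩
    have h5 := hslope d hd j' (coeff_leadT_of_mem_deltaMJ ha0 hmem)
    have hjj : (j' : ℝ) ≤ j := by exact_mod_cast (show j' ≤ j by omega)
    -- The slope bound at j' ≤ j and the equality r = p + sj force sj' = sj. For s = 0 the true
    -- index j' of the pair may still be smaller than j.
    have h6 : (d.2 : ℝ) = p + s * j' := by
      have := mul_le_mul_of_nonneg_left hjj hs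
      linarith
    have hpd : p ≤ d.2 := by
      have : (p : ℝ) ≤ d.2 := by
        rw [h6]
        have : 0 ≤ s * j' := by positivity
        linarith
      exact_mod_cast this
    obtain ⟨k, hk⟩ := Nat.exists_eq_add_of_le hpd
    refine le_trans ?_ (hdeg j' k ?_)
    · exact Finset.le_sup (f := fun d : ℕ × ℕ => d.1 - m) (Finset.mem_filter.2 ⟨hmem, hk⟩)
    · rw [hk] at h6
      push_cast at h6
      linarith
  obtain ⟨C, hC, hCle⟩ := muTerm_le hs hA hB hG hl hslope
  obtain ⟨d0, hd0, hd0D⟩ : ∃ d ∈ (deltaMJ Δ a m ((0 : ℕ) : ℤ)).filter (fun d => d.2 = p),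
      d.1 - m = D := by
    obtain ⟨d, hd, hdp⟩ := exists_pIndex hne hl
    obtain ⟨d', hd', he⟩ := Finset.exists_mem_eq_sup
      ((deltaMJ Δ a m ((0 : ℕ) : ℤ)).filter (fun d => d.2 = p))
      ⟨d, Finset.mem_filter.2 ⟨by simpa using hd, hdp⟩⟩ (fun d => d.1 - m)
    exact ⟨d', hd', he.symm⟩
  rw [Finset.mem_filter] at hd0
  have hd0S := (mem_deltaMJ.1 hd0.1).1
  have hγ : muTerm s a m p d0 0 ≠ 0 := (muTerm_ne_zero_iff hs).2
    ⟨by simp [hd0.2], coeff_leadT_of_mem_deltaMJ ha0 hd0.1⟩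
  have hlim := tendsto_sum_descFactorial (deltaM Δ a m) (fun d => d.1 - m)
    (fun d => muTerm s a m p d 0) (D := D) fun d hd hne' => hDle d hd 0 hne'
  rw [sum_muTerm_eq hs hd0S hd0D hγ] at hlim
  have hpos : 0 < ‖muTerm s a m p d0 0‖ := norm_pos_iff.2 hγ
  have hlarge := hlim.norm.eventually_const_lt (half_lt_self hpos)
  have hgen : ∀ᶠ n in atTop, SmallRatio s Δ a m n B (2 * C / ‖muTerm s a m p d0 0‖) := by
    filter_upwards [hlarge, hev, eventually_ge_atTop 1] with n hn hsb hn1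
    have hn0 : (0 : ℝ) < n := by exact_mod_cast hn1
    rw [← mu_tildeP, norm_div, norm_pow, Complex.norm_natCast, lt_div_iff₀ (by positivity)] at hn
    refine ⟨p, hsb.2, lt_of_le_of_lt (by positivity) hn, fun j => ?_⟩
    calc _ ≤ (n : ℝ) ^ D * ∑ d ∈ deltaM Δ a m, ‖muTerm s a m p d j‖ :=
          norm_mu_tildeP_le hn1 fun d hd => hDle d hd j
      _ ≤ (n : ℝ) ^ D * (C * (2 * B) ^ j) := by
          gcongr
          exact hCle j
      _ = 2 * C / ‖muTerm s a m p d0 0‖ * (2 * B) ^ j *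
            (‖muTerm s a m p d0 0‖ / 2 * (n : ℝ) ^ D) := by
          field_simp
      _ ≤ _ := by gcongr
  obtain ⟨n0, hn0⟩ := eventually_atTop.1 hgen
  choose Cs hCs hsm using hsingle
  refine ⟨2 * C / ‖muTerm s a m p d0 0‖ + ∑ n ∈ Finset.range n0, Cs n,
    add_nonneg (by positivity) (Finset.sum_nonneg fun n _ => hCs n), fun n => ?_⟩
  rcases lt_or_ge n n0 with h | h
  · refine hmono ?_ (hsm n)
    have := Finset.single_le_sum (fun n _ => hCs n) (Finset.mem_range.2 h)
    have : 0 ≤ 2 * C / ‖muTerm s a m p d0 0‖ := by positivity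
    linarith
  · refine hmono ?_ (hn0 n h)
    have := Finset.sum_nonneg fun n (_ : n ∈ Finset.range n0) => hCs n
    linarith

/-- The radius uses only B and C. The vertex p, the constant A' and the column from which the
diagonal dominates may vary with n. -/
theorem exists_radius_of_smallRatio (hs : 0 ≤ s) (hB : 0 < B) {C c : ℝ} (hC : 0 ≤ C) (hc : 0 < c)
    (hl : lowerIndex Δ a m = 0) (hW : ∀ n k : ℕ, c ≤ ‖bigW Δ a m n k‖)
    (hsmall : ∀ n, SmallRatio s Δ a m n B C) :
    ∃ ρ₀ : ℝ, 0 < ρ₀ ∧ ∀ ρ, 0 < ρ → ρ ≤ ρ₀ → ∀ (n : ℕ) (u : ℂ⟦X⟧),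
      diffOp (tildeP Δ a m n) (orderBound Δ a m) u ∈ gevreyDisc s ρ hs →
        u ∈ gevreyDisc s ρ hs := by
  refine ⟨(2 * B * (1 + 2 * C))⁻¹, by positivity, fun ρ hρ hρ0 n u hu => ?_⟩
  obtain ⟨p, ⟨A', hA', hb⟩, h0, hle⟩ := hsmall n
  rw [mem_gevreyDisc_iff hs hρ] at hu ⊢
  intro R hR hRρ
  have hRlt : R * (2 * B) * (1 + 2 * C) < 1 := by
    have := hRρ.trans_le hρ0
    rw [lt_inv_comm₀ hR (by positivity)] at this
    have h2 := mul_lt_mul_of_pos_left this hR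
    rw [mul_inv_cancel₀ hR.ne'] at h2
    linarith
  refine hb.summable_of_diffOp hs hA' hB.le hR ?_ ?_ hc (fun k => ?_) (hu R hR hRρ)
  · have : 0 < R * (2 * B) := by positivity
    nlinarith
  · exact tsum_lt_half (x := fun j => ‖mu s (tildeP Δ a m n) (orderBound Δ a m) p j‖)
      (fun j => norm_nonneg _) h0 hC (by positivity) hle hR hRlt
  · rw [opCoeff_tildeP hl]
    exact hW n k

/-- With D the largest degree in n that occurs, mu_j/n^D has limits γ_j of which γ_0 is 0, since D >
deg w_{p0}. For the least J with γ_J ≠ 0 the term |γ_J| R^J dominates when R is small, and by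
dominated convergence the same holds for mu_j at all large n. -/
theorem eventually_exists_preimage_notMem (hs : 0 ≤ s) (hA : 0 < A) (hB : 0 < B)
    (hG : ∀ d ∈ deltaM Δ a m, ∀ i,
      ‖PowerSeries.coeff i (leadT a m d)‖ ≤ A * B ^ i * gam s i)
    (ha0 : ∀ d ∈ Δ, a d ≠ 0) (hne : (deltaM Δ a m).Nonempty) (hl : lowerIndex Δ a m = 0)
    (h_a : ∀ n, IsLowerOrdinate (newtonPolygon (tildeP Δ a m n)) 0)
    (h_b : ∀ n, (ENNReal.ofReal s)⁻¹ ≤ firstPositiveSlope (newtonPolygon (tildeP Δ a m n)))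
    (hW : ∀ n k : ℕ, bigW Δ a m n k ≠ 0)
    {j₀ k₀ : ℕ} (hk₀ : (k₀ : ℝ) = (j₀ : ℝ) * s)
    (hdeg : degW Δ a m (pIndex Δ a m) 0 < degW Δ a m (pIndex Δ a m + k₀) j₀)
    {ρ : ℝ} (hρ : 0 < ρ) :
    ∀ᶠ n in atTop, ∃ K : ℕ, ∀ u : ℂ⟦X⟧,
      diffOp (tildeP Δ a m n) (orderBound Δ a m) u = X ^ K → u ∉ gevreyDisc s ρ hs := by
  classical
  have hev := eventually_slopeBound_tildeP hs hA hG ha0 hne hl h_a h_b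
  have hslope : ∀ d ∈ deltaM Δ a m, ∀ j, PowerSeries.coeff (d.2 + j) (leadT a m d) ≠ 0 →
      (d.2 : ℝ) ≤ pIndex Δ a m + s * j := fun d hd j hc =>
    slope_leadT (hev.mono fun n hn => ⟨hn.2.choose, hn.2.choose_spec.2⟩) hd hc
  set p := pIndex Δ a m with hp
  obtain ⟨C, hC, hCle⟩ := muTerm_le hs hA hB hG hl hslope
  obtain ⟨d0, hd0, hd0D⟩ : ∃ d ∈ deltaM Δ a m, (∃ j, muTerm s a m p d j ≠ 0) ∧
      degW Δ a m p 0 < d.1 - m := by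
    unfold degW at hdeg
    obtain ⟨d, hd, hlt⟩ := Finset.lt_sup_iff.1 hdeg
    rw [Finset.mem_filter] at hd
    refine ⟨d, (mem_deltaMJ.1 hd.1).1, ⟨j₀, (muTerm_ne_zero_iff hs).2
      ⟨?_, coeff_leadT_of_mem_deltaMJ ha0 hd.1⟩⟩, hlt⟩
    rw [hd.2]
    push_cast
    linarith
  obtain ⟨d1, hd1, hmax⟩ := ((deltaM Δ a m).filter fun d =>
    ∃ j, muTerm s a m p d j ≠ 0).exists_max_image (fun d => d.1 - m)
    ⟨d0, Finset.mem_filter.2 ⟨hd0, hd0D.1⟩⟩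
  have hDlt := hd0D.2.trans_le (hmax d0 (Finset.mem_filter.2 ⟨hd0, hd0D.1⟩))
  rw [Finset.mem_filter] at hd1
  obtain ⟨hd1S, j1, hj1⟩ := hd1
  set D := d1.1 - m with hD
  have hDle : ∀ d ∈ deltaM Δ a m, ∀ j, muTerm s a m p d j ≠ 0 → d.1 - m ≤ D := fun d hd j h =>
    hmax d (Finset.mem_filter.2 ⟨hd, j, h⟩)
  let γ : ℕ → ℂ := fun j => ∑ d ∈ deltaM Δ a m, if d.1 - m = D then muTerm s a m p d j else 0
  have hlim : ∀ j, Tendsto (fun n : ℕ =>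
      ‖mu s (tildeP Δ a m n) (orderBound Δ a m) p j‖ / (n : ℝ) ^ D) atTop (𝓝 ‖γ j‖) := by
    intro j
    have h := (tendsto_sum_descFactorial (deltaM Δ a m) (fun d => d.1 - m)
      (fun d => muTerm s a m p d j) (D := D) fun d hd => hDle d hd j).norm
    refine h.congr fun n => ?_
    rw [← mu_tildeP, norm_div, norm_pow, Complex.norm_natCast]
  have hγle : ∀ j, ‖γ j‖ ≤ C * (2 * B) ^ j := by
    intro j
    refine le_trans ((norm_sum_le _ _).trans (Finset.sum_le_sum fun d _ => ?_)) (hCle j)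
    split_ifs <;> simp
  have hex : ∃ j, γ j ≠ 0 := ⟨j1, by
    simp only [γ]
    rw [sum_muTerm_eq hs hd1S rfl hj1]
    exact hj1⟩
  obtain ⟨J, hJne, hJmin⟩ : ∃ J, γ J ≠ 0 ∧ ∀ j < J, γ j = 0 :=
    ⟨Nat.find hex, Nat.find_spec hex, fun j hj => not_not.1 (Nat.find_min hex hj)⟩
  have hγ0 : γ 0 = 0 := by
    refine Finset.sum_eq_zero fun d hd => ?_
    split_ifs with h
    · by_contra hc
      obtain ⟨h1, h2⟩ := (muTerm_ne_zero_iff hs).1 hc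
      have hdp : d.2 = p := by
        have : (d.2 : ℝ) = p := by simpa using h1
        exact_mod_cast this
      have hmem : d ∈ deltaMJ Δ a m ((0 : ℕ) : ℤ) := by
        simpa using mem_deltaMJ_zero hl hd (by simpa using h2)
      have : d.1 - m ≤ degW Δ a m p 0 :=
        Finset.le_sup (f := fun d : ℕ × ℕ => d.1 - m) (Finset.mem_filter.2 ⟨hmem, hdp⟩)
      omega
    · rfl
  have hJ1 : 1 ≤ J := by
    rcases Nat.eq_zero_or_pos J with h | h
    · rw [h] at hJne
      exact absurd hγ0 hJne
    · exact h
  have hγJ : 0 < ‖γ J‖ := norm_pos_iff.2 hJne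
  set E : ℝ := 1 + 2 * (C * (2 * B) ^ J / ‖γ J‖) with hE
  have hE1 : 1 ≤ E := by
    have : 0 ≤ C * (2 * B) ^ J / ‖γ J‖ := by positivity
    linarith
  -- R < ρ makes membership in G_s(ρ) yield summability at R; the second bound makes γ_J dominate.
  obtain ⟨R, hR, hRlt⟩ := exists_between
    (show (0 : ℝ) < min ρ (2 * B * E)⁻¹ by positivity)
  have hRρ := hRlt.trans_le (min_le_left _ _)
  have hRE : R * (2 * B) * E < 1 := by
    have := hRlt.trans_le (min_le_right _ _)
    rw [lt_inv_comm₀ hR (by positivity)] at this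
    have h2 := mul_lt_mul_of_pos_left this hR
    rw [mul_inv_cancel₀ hR.ne'] at h2
    linarith
  have hRB : R * (2 * B) < 1 := by
    have : 0 < R * (2 * B) := by positivity
    nlinarith
  have hγsum := tsum_lt_half_of_least (x := fun j => ‖γ j‖) (fun j => norm_nonneg _) hγJ
    (fun j hj => by simp [hJmin j hj]) hC (by positivity) hγle hR hRE
  have hlim1 : Tendsto (fun n : ℕ => ∑' j, (if j = J then 0 else
      ‖mu s (tildeP Δ a m n) (orderBound Δ a m) p j‖ * R ^ j) / (n : ℝ) ^ D) atTop
      (𝓝 (∑' j, if j = J then 0 else ‖γ j‖ * R ^ j)) := by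
    refine tendsto_tsum_of_dominated_convergence (bound := fun j => C * (R * (2 * B)) ^ j)
      ((summable_geometric_of_lt_one (by positivity) hRB).mul_left _) (fun j => ?_) ?_
    · split_ifs
      · simp
      · refine ((hlim j).mul_const (R ^ j)).congr fun n => ?_
        ring
    · filter_upwards [eventually_ge_atTop 1] with n hn j
      have hn0 : (0 : ℝ) < n := by exact_mod_cast hn
      split_ifs
      · simp only [zero_div, norm_zero]
        positivity
      · rw [Real.norm_of_nonneg (by positivity), div_le_iff₀ (by positivity)]
        calc _ ≤ ((n : ℝ) ^ D * (C * (2 * B) ^ j)) * R ^ j := by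
              gcongr
              exact (norm_mu_tildeP_le hn fun d hd => hDle d hd j).trans (by
                gcongr
                exact hCle j)
          _ = _ := by rw [mul_pow R]; ring
  have hlim2 := ((hlim J).mul_const (R ^ J)).const_mul (1 / 2)
  filter_upwards [hlim1.eventually_lt hlim2 hγsum, hev, eventually_ge_atTop 1]
    with n hn hsb hn1
  have hn0 : (0 : ℝ) < n := by exact_mod_cast hn1
  obtain ⟨-, A', hA', hb⟩ := hsb
  refine hb.exists_preimage_notMem hs hA' hB.le hR hRρ hRB hJ1 ?_ fun k => ?_
  · rw [tsum_div_const, div_lt_iff₀ (by positivity)] at hn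
    refine hn.trans_le (le_of_eq ?_)
    field_simp
  · rw [opCoeff_tildeP hl]
    exact hW n k

end Family

/-! ### Triangularity with respect to `t` -/

theorem coeff_dt_pow (q n : ℕ) (u : ℂ⟦X⟧⟦X⟧) : PowerSeries.coeff n ((dt ^ q) u) =
    ((n + 1).ascFactorial q : ℂ) • PowerSeries.coeff (n + q) u := by
  induction q generalizing u with
  | zero => simp
  | succ q ih =>
    rw [pow_succ, Module.End.mul_apply, ih]
    simp only [dt, LinearMap.coe_mk, AddHom.coe_mk, PowerSeries.coeff_mk, smul_smul]
    rw [Nat.ascFactorial_succ]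
    congr 1
    push_cast
    ring

theorem coeff_dz_pow (r n : ℕ) (u : ℂ⟦X⟧⟦X⟧) : PowerSeries.coeff n ((dz ^ r) u) =
    (PowerSeries.derivative ℂ)^[r] (PowerSeries.coeff n u) := by
  induction r generalizing u with
  | zero => simp
  | succ r ih =>
    rw [pow_succ, Module.End.mul_apply, ih, Function.iterate_succ_apply]
    simp [dz]

theorem coeff_dtInv_pow (m n : ℕ) (u : ℂ⟦X⟧⟦X⟧) : PowerSeries.coeff n ((dtInv ^ m) u) =
    if n < m then 0 else (n.descFactorial m : ℂ)⁻¹ • PowerSeries.coeff (n - m) u := by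
  induction m generalizing n with
  | zero => simp
  | succ m ih =>
    rw [pow_succ', Module.End.mul_apply]
    simp only [dtInv, LinearMap.coe_mk, AddHom.coe_mk, PowerSeries.coeff_mk]
    rcases n with _ | n
    · simp
    · change (if n + 1 = 0 then 0 else ((n + 1 : ℕ) : ℂ)⁻¹ •
        PowerSeries.coeff (n + 1 - 1) ((dtInv ^ m) u)) = _
      rw [if_neg (by omega), Nat.add_sub_cancel, ih]
      by_cases h : n < m
      · rw [if_pos h, if_pos (by omega), smul_zero]
      · rw [if_neg h, if_neg (by omega), smul_smul, Nat.succ_descFactorial_succ,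
          Nat.add_sub_add_right]
        congr 1
        push_cast
        rw [mul_inv]

theorem iterate_derivative_smul (r : ℕ) (c : ℂ) (u : ℂ⟦X⟧) :
    (PowerSeries.derivative ℂ)^[r] (c • u) = c • (PowerSeries.derivative ℂ)^[r] u := by
  ext k
  simp only [PowerSeries.coeff_iterate_derivative, PowerSeries.coeff_smul, smul_eq_mul]
  ring

theorem iterate_derivative_zero (r : ℕ) :
    (PowerSeries.derivative ℂ)^[r] (0 : ℂ⟦X⟧) = 0 := by
  simp

theorem fullOp_apply (Δ : Finset (ℕ × ℕ)) (a : ℕ × ℕ → ℂ⟦X⟧⟦X⟧) (m : ℕ) (u : ℂ⟦X⟧⟦X⟧) :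
    fullOp Δ a m u = ∑ d ∈ Δ, a d * (dt ^ d.1) ((dz ^ d.2) ((dtInv ^ m) u)) := by
  simp [fullOp, LinearMap.sum_apply]

/-- A factor t^i of a_{qr} has i ≥ ord_t a_{qr} ≥ q - m, so P∂_t^{-m} never lowers the degree in t.
The degree is kept only by the leading coefficients of the pairs in Δ_m. -/
theorem coeff_fullOp_of_lt {Δ : Finset (ℕ × ℕ)} {a : ℕ × ℕ → ℂ⟦X⟧⟦X⟧} {m : ℕ}
    (hm : ∀ d ∈ Δ, (d.1 : ℤ) - (ordT a d : ℤ) ≤ m) {n : ℕ} {u : ℂ⟦X⟧⟦X⟧}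
    (hu : ∀ i < n, PowerSeries.coeff i u = 0) :
    PowerSeries.coeff n (fullOp Δ a m u) =
      diffOp (tildeP Δ a m n) (orderBound Δ a m) (PowerSeries.coeff n u) := by
  have hR : diffOp (tildeP Δ a m n) (orderBound Δ a m) (PowerSeries.coeff n u) =
      ∑ d ∈ deltaM Δ a m, ((n.descFactorial (d.1 - m) : ℂ) • leadT a m d) *
        (PowerSeries.derivative ℂ)^[d.2] (PowerSeries.coeff n u) := by
    rw [← sum_range_orderBound (Δ := Δ) (a := a) (m := m) _ subset_rfl]
    unfold diffOp tildeP
    refine Finset.sum_congr rfl fun r _ => ?_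
    rw [Finset.sum_mul]
    refine Finset.sum_congr rfl fun d hd => ?_
    rw [(Finset.mem_filter.1 hd).2]
  rw [hR, fullOp_apply, map_sum, deltaM, Finset.sum_filter]
  refine Finset.sum_congr rfl fun d hd => ?_
  have hmd := hm d hd
  rw [PowerSeries.coeff_mul]
  have hterm : ∀ i l : ℕ, i + l = n → ¬ ((d.1 : ℤ) - ordT a d = m ∧ i = d.1 - m) →
      PowerSeries.coeff i (a d) *
        PowerSeries.coeff l ((dt ^ d.1) ((dz ^ d.2) ((dtInv ^ m) u))) = 0 := by
    intro i l hil hne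
    by_cases hi : i < ordT a d
    · rw [PowerSeries.coeff_of_lt_order_toNat i hi, zero_mul]
    · rw [coeff_dt_pow, coeff_dz_pow, coeff_dtInv_pow]
      by_cases hlm : l + d.1 < m
      · rw [if_pos hlm, iterate_derivative_zero, smul_zero, mul_zero]
      · have : l + d.1 - m < n := by
          by_contra hc
          exact hne (by omega)
        rw [if_neg hlm, hu _ this, smul_zero, iterate_derivative_zero, smul_zero, mul_zero]
  split_ifs with h
  · by_cases hn : d.1 - m ≤ n
    · rw [Finset.sum_eq_single_of_mem (d.1 - m, n - (d.1 - m))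
        (Finset.HasAntidiagonal.mem_antidiagonal.2 (by simp only; omega)) fun x hx hxne => ?_]
      · have hmd1 : m ≤ d.1 := by omega
        have e1 : n - (d.1 - m) + d.1 = n + m := by omega
        rw [coeff_dt_pow, coeff_dz_pow, coeff_dtInv_pow, if_neg (by omega), e1,
          Nat.add_sub_cancel, iterate_derivative_smul, smul_smul]
        -- Differentiating t^(n+m) q times yields the factor from integrating t^n m times, which
        -- cancels, and n(n-1)⋯(n-(q-m)+1).
        have e2 : (n - (d.1 - m) + 1).ascFactorial d.1 =
            n.descFactorial (d.1 - m) * (n + m).descFactorial m := by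
          rw [← Nat.add_descFactorial_eq_ascFactorial, e1,
            ← Nat.descFactorial_mul_descFactorial hmd1, Nat.add_sub_cancel]
        have e3 : ((n + m).descFactorial m : ℂ) ≠ 0 := by
          have : (n + m).descFactorial m ≠ 0 := by
            rw [Ne, Nat.descFactorial_eq_zero_iff_lt]
            omega
          exact_mod_cast this
        rw [e2]
        push_cast
        rw [mul_inv_cancel_right₀ e3, mul_smul_comm, smul_mul_assoc]
        rfl
      · rw [Finset.HasAntidiagonal.mem_antidiagonal] at hx
        refine hterm x.1 x.2 hx fun hc => hxne (Prod.ext hc.2 ?_)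
        simp only
        omega
    -- If q - m > n the leading power of t is already too high, in agreement with the vanishing
    -- falling factorial.
    · rw [Nat.descFactorial_of_lt (not_le.1 hn)]
      simp only [Nat.cast_zero, zero_smul, zero_mul]
      refine Finset.sum_eq_zero fun x hx => ?_
      rw [Finset.HasAntidiagonal.mem_antidiagonal] at hx
      exact hterm x.1 x.2 hx (by omega)
  · refine Finset.sum_eq_zero fun x hx => ?_
    rw [Finset.HasAntidiagonal.mem_antidiagonal] at hx
    exact hterm x.1 x.2 hx fun hc => h hc.1

/-- All coefficients with respect to `t` belong to `G_s(ρ)`. -/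
def CoeffMem (s ρ : ℝ) (hs : 0 ≤ s) (u : ℂ⟦X⟧⟦X⟧) : Prop :=
  ∀ n : ℕ, PowerSeries.coeff n u ∈ gevreyDisc s ρ hs

theorem coeffMem_fullOp {s r ρ : ℝ} {hs : 0 ≤ s} {Δ : Finset (ℕ × ℕ)} {a : ℕ × ℕ → ℂ⟦X⟧⟦X⟧}
    (m : ℕ) (haG : ∀ d ∈ Δ, ∀ n : ℕ, PowerSeries.coeff n (a d) ∈ gevreyDisc s r hs)
    (hρ : 0 < ρ) (hρr : ρ ≤ r) {u : ℂ⟦X⟧⟦X⟧} (hu : CoeffMem s ρ hs u) :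
    CoeffMem s ρ hs (fullOp Δ a m u) := by
  intro n
  rw [fullOp_apply, map_sum]
  refine Submodule.sum_mem _ fun d hd => ?_
  rw [PowerSeries.coeff_mul]
  refine Submodule.sum_mem _ fun x _ =>
    mul_mem_gevreyDisc hs hρ (gevreyDisc_anti hs hρr (haG d hd _)) ?_
  rw [coeff_dt_pow, coeff_dz_pow, coeff_dtInv_pow]
  refine Submodule.smul_mem _ _ ?_
  have hiter : ∀ (r : ℕ) (v : ℂ⟦X⟧), v ∈ gevreyDisc s ρ hs →
      (PowerSeries.derivative ℂ)^[r] v ∈ gevreyDisc s ρ hs := by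
    intro r v hv
    induction r with
    | zero => exact hv
    | succ r ih =>
      rw [Function.iterate_succ_apply']
      exact derivative_mem_gevreyDisc hs hρ ih
  refine hiter _ _ ?_
  split_ifs
  · exact Submodule.zero_mem _
  · exact Submodule.smul_mem _ _ (hu _)

/-! ### Recursive solution in powers of t -/

section Triangular

/-- The part of degree less than `n` in `t`. -/
noncomputable def lowPart (n : ℕ) (u : ℂ⟦X⟧⟦X⟧) : ℂ⟦X⟧⟦X⟧ :=
  PowerSeries.mk fun i => if i < n then PowerSeries.coeff i u else 0

variable {L : ℂ⟦X⟧⟦X⟧ →ₗ[ℂ] ℂ⟦X⟧⟦X⟧} {Q : ℕ → ℂ⟦X⟧ → ℂ⟦X⟧}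
  (hLQ : ∀ (n : ℕ) (u : ℂ⟦X⟧⟦X⟧), (∀ i < n, PowerSeries.coeff i u = 0) →
    PowerSeries.coeff n (L u) = Q n (PowerSeries.coeff n u))

include hLQ in
theorem coeff_triangular (n : ℕ) (u : ℂ⟦X⟧⟦X⟧) : PowerSeries.coeff n (L u) =
    PowerSeries.coeff n (L (lowPart n u)) + Q n (PowerSeries.coeff n u) := by
  have h := hLQ n (u - lowPart n u) fun i hi => by simp [lowPart, hi]
  rw [map_sub, map_sub, map_sub] at h
  rw [sub_eq_iff_eq_add'.1 h]
  simp [lowPart]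

include hLQ in
theorem injective_of_triangular (hQ : ∀ n, Function.Injective (Q n)) : Function.Injective L := by
  rw [← LinearMap.ker_eq_bot, LinearMap.ker_eq_bot']
  intro u hu
  ext n : 1
  induction n using Nat.strong_induction_on with
  | _ n ih =>
    have h1 := hLQ n u fun i hi => by simpa using ih i hi
    have h2 := hLQ n 0 fun i hi => by simp
    rw [hu] at h1
    rw [map_zero] at h2
    exact hQ n (h1.symm.trans h2)

/-- The map Φ_n is arbitrary, so that right-hand sides may be chosen in the course of the recursion,
depending on the part of u already built. -/
theorem exists_recursive (L : ℂ⟦X⟧⟦X⟧ →ₗ[ℂ] ℂ⟦X⟧⟦X⟧) (Φ : ℕ → ℂ⟦X⟧ → ℂ⟦X⟧) :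
    ∃ u : ℂ⟦X⟧⟦X⟧, ∀ n, PowerSeries.coeff n u = Φ n (PowerSeries.coeff n (L (lowPart n u))) := by
  let c : (n : ℕ) → ((k : ℕ) → k < n → ℂ⟦X⟧) → ℂ⟦X⟧ := fun n w =>
    Φ n (PowerSeries.coeff n (L (PowerSeries.mk fun i => if h : i < n then w i h else 0)))
  let w : ℕ → ℂ⟦X⟧ := fun n => Nat.strongRec (motive := fun _ => ℂ⟦X⟧) c n
  have hw : ∀ n, w n = c n fun k _ => w k := by
    intro n
    simp only [w]
    rw [Nat.strongRec]
  refine ⟨PowerSeries.mk w, fun n => ?_⟩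
  rw [PowerSeries.coeff_mk, hw n]
  simp [c, lowPart]

end Triangular

/-! ### From the operators in z to the automorphism -/

section Automorphism

variable {s : ℝ} {hs : 0 ≤ s} {L : ℂ⟦X⟧⟦X⟧ →ₗ[ℂ] ℂ⟦X⟧⟦X⟧} {Q : ℕ → ℂ⟦X⟧ → ℂ⟦X⟧} {r : ℝ}

/-- Each step of the recursion for u stays in G_s(ρ) with the same ρ, because ρ₀ does not depend on
n; the radius does not shrink along the way. -/
theorem inducesAut_of_triangular (hr : 0 < r)
    (hLQ : ∀ (n : ℕ) (u : ℂ⟦X⟧⟦X⟧), (∀ i < n, PowerSeries.coeff i u = 0) →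
      PowerSeries.coeff n (L u) = Q n (PowerSeries.coeff n u))
    (hL : ∀ ρ, 0 < ρ → ρ ≤ r → ∀ u, CoeffMem s ρ hs u → CoeffMem s ρ hs (L u))
    (hQ : ∀ n, Function.Bijective (Q n)) {ρ₀ : ℝ} (hρ₀ : 0 < ρ₀)
    (hQmem : ∀ ρ, 0 < ρ → ρ ≤ ρ₀ → ∀ n u,
      Q n u ∈ gevreyDisc s ρ hs → u ∈ gevreyDisc s ρ hs) :
    InducesAut L (gevreySeries s hs) := by
  have hmaps : ∀ u ∈ gevreySeries s hs, L u ∈ gevreySeries s hs := by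
    rintro u ⟨ρ, hρ, hu⟩
    exact ⟨min ρ r, lt_min hρ hr, hL _ (lt_min hρ hr) (min_le_right _ _) u fun n =>
      gevreyDisc_anti hs (min_le_left _ _) (hu n)⟩
  have hinj := injective_of_triangular hLQ fun n => (hQ n).1
  have hsurj : ∀ f ∈ gevreySeries s hs, ∃ u ∈ gevreySeries s hs, L u = f := by
    rintro f ⟨ρ', hρ', hf'⟩
    set ρ := min ρ' (min r ρ₀) with hρdef
    have hρ : 0 < ρ := lt_min hρ' (lt_min hr hρ₀)
    have hf : CoeffMem s ρ hs f := fun n => gevreyDisc_anti hs (min_le_left _ _) (hf' n)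
    choose Qinv hQinv using fun n => (hQ n).2
    obtain ⟨u, hu⟩ := exists_recursive L fun n w => Qinv n (PowerSeries.coeff n f - w)
    have hQu : ∀ n, Q n (PowerSeries.coeff n u) =
        PowerSeries.coeff n f - PowerSeries.coeff n (L (lowPart n u)) := fun n => by
      rw [hu n, hQinv]
    refine ⟨u, ⟨ρ, hρ, fun n => ?_⟩, ?_⟩
    · induction n using Nat.strong_induction_on with
      | _ n ih =>
        refine hQmem ρ hρ ((min_le_right _ _).trans (min_le_right _ _)) n _ ?_
        rw [hQu n]
        refine Submodule.sub_mem _ (hf n)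
          (hL ρ hρ ((min_le_right _ _).trans (min_le_left _ _)) _ (fun i => ?_) n)
        simp only [lowPart, PowerSeries.coeff_mk]
        split_ifs with hi
        · exact ih i hi
        · exact Submodule.zero_mem _
    · ext n : 1
      rw [coeff_triangular hLQ, hQu n]
      ring
  refine ⟨LinearEquiv.ofBijective (L.restrict hmaps) ⟨fun u v huv => ?_, fun f => ?_⟩,
    fun u => rfl⟩
  · exact Subtype.ext (hinj (congrArg Subtype.val huv))
  · obtain ⟨u, hu, hLu⟩ := hsurj f f.2
    exact ⟨⟨u, hu⟩, Subtype.ext hLu⟩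

/-- A right-hand side f with coefficients in G_s(1) is built along with its formal preimage u. At
strictly increasing degrees φ(i) the coefficient of f is chosen so that u_{φ(i)} is not in
G_s(1/(i+1)). No common radius for u is left, and by injectivity there is no other preimage. -/
theorem not_inducesAut_of_triangular
    (hLQ : ∀ (n : ℕ) (u : ℂ⟦X⟧⟦X⟧), (∀ i < n, PowerSeries.coeff i u = 0) →
      PowerSeries.coeff n (L u) = Q n (PowerSeries.coeff n u))
    (hQ : ∀ n, Function.Bijective (Q n))
    (hQsub : ∀ n u v, Q n (u - v) = Q n u - Q n v)
    (hbad : ∀ ρ : ℝ, 0 < ρ → ∀ᶠ n in atTop, ∃ K : ℕ, ∀ u : ℂ⟦X⟧, Q n u = X ^ K →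
      u ∉ gevreyDisc s ρ hs) :
    ¬ InducesAut L (gevreySeries s hs) := by
  rintro ⟨e, he⟩
  have hinj := injective_of_triangular hLQ fun n => (hQ n).1
  choose Qinv hQinv using fun n => (hQ n).2
  obtain ⟨φ, hφ, hbadφ⟩ := extraction_forall_of_eventually
    (P := fun i n => ∃ K : ℕ, ∀ u : ℂ⟦X⟧, Q n u = X ^ K →
      u ∉ gevreyDisc s (1 / ((i : ℝ) + 1)) hs) fun i => hbad _ (by positivity)
  have hchoice : ∀ (n : ℕ) (w : ℂ⟦X⟧), ∃ g : ℂ⟦X⟧, g ∈ gevreyDisc s 1 hs ∧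
      ∀ i, φ i = n → Qinv n (g - w) ∉ gevreyDisc s (1 / ((i : ℝ) + 1)) hs := by
    intro n w
    by_cases hn : ∃ i, φ i = n
    · obtain ⟨i, rfl⟩ := hn
      obtain ⟨K, hK⟩ := hbadφ i
      -- One of the right-hand sides 0 and z^K must fail: otherwise the difference of the two
      -- solutions would be a preimage of z^K in the forbidden space.
      by_cases h0 : Qinv (φ i) (0 - w) ∈ gevreyDisc s (1 / ((i : ℝ) + 1)) hs
      · refine ⟨X ^ K, X_pow_mem_gevreyDisc hs one_pos K, fun i' hi' hmem => ?_⟩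
        rw [hφ.injective hi'] at hmem
        refine hK (Qinv (φ i) (X ^ K - w) - Qinv (φ i) (0 - w)) ?_ (Submodule.sub_mem _ hmem h0)
        rw [hQsub, hQinv, hQinv]
        ring
      · refine ⟨0, Submodule.zero_mem _, fun i' hi' => ?_⟩
        rw [hφ.injective hi']
        exact h0
    · exact ⟨0, Submodule.zero_mem _, fun i hi => absurd ⟨i, hi⟩ hn⟩
  choose g hg hgbad using hchoice
  obtain ⟨u, hu⟩ := exists_recursive L fun n w => Qinv n (g n w - w)
  have hf : L u ∈ gevreySeries s hs := by
    refine ⟨1, one_pos, fun n => ?_⟩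
    rw [coeff_triangular hLQ, hu n, hQinv, add_sub_cancel]
    exact hg _ _
  have hmem : u ∈ gevreySeries s hs := by
    have h1 := he (e.symm ⟨L u, hf⟩)
    rw [LinearEquiv.apply_symm_apply] at h1
    rw [hinj h1]
    exact (e.symm ⟨L u, hf⟩).2
  obtain ⟨ρ, hρ, hmem⟩ := hmem
  obtain ⟨i, hi⟩ := exists_nat_one_div_lt hρ
  have hb := hgbad (φ i) (PowerSeries.coeff (φ i) (L (lowPart (φ i) u))) i rfl
  rw [← hu (φ i)] at hb
  refine hb ?_
  exact gevreyDisc_anti hs hi.le (hmem (φ i))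

end Automorphism

theorem alpha_eq_zero_iff (Δ : Finset (ℕ × ℕ)) (a : ℕ × ℕ → ℂ⟦X⟧⟦X⟧) (m : ℕ) (s : ℝ) :
    alpha Δ a m s = 0 ↔ ∀ j k : ℕ, (k : ℝ) = (j : ℝ) * s →
      degW Δ a m (pIndex Δ a m + k) j ≤ degW Δ a m (pIndex Δ a m) 0 := by
  have hbdd := alphaSet_bddAbove Δ a m s
  have h0 : (0 : ℝ) ∈ alphaSet Δ a m s := Set.mem_insert _ _
  constructor
  · intro h j k hjk
    rcases Nat.eq_zero_or_pos j with rfl | hj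
    · have : k = 0 := by simpa using hjk
      simp [this]
    · have h1 := le_csSup hbdd (Set.mem_insert_of_mem _ ⟨j, k, hj, hjk, rfl⟩)
      rw [show sSup _ = (0 : ℝ) from h] at h1
      have hj' : (0 : ℝ) < j := by exact_mod_cast hj
      rw [div_le_iff₀ hj', zero_mul, sub_nonpos] at h1
      exact_mod_cast h1
  · intro h
    refine le_antisymm (csSup_le ⟨0, h0⟩ ?_) (le_csSup hbdd h0)
    rintro x (rfl | ⟨j, k, -, hjk, rfl⟩)
    · rfl
    · refine div_nonpos_of_nonpos_of_nonneg ?_ (by positivity)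
      rw [sub_nonpos]
      exact_mod_cast h j k hjk

theorem diffOp_sub (b : ℕ → ℂ⟦X⟧) (N : ℕ) (u v : ℂ⟦X⟧) :
    diffOp b N (u - v) = diffOp b N u - diffOp b N v := by
  unfold diffOp
  rw [← Finset.sum_sub_distrib]
  refine Finset.sum_congr rfl fun r _ => ?_
  rw [← mul_sub]
  congr 1
  ext k
  simp only [PowerSeries.coeff_iterate_derivative, map_sub]
  ring

end GevreyAut

theorem corollary1
    (s r : ℝ) (hs : 0 ≤ s) (hr : 0 < r)
    (Δ : Finset (ℕ × ℕ)) (a : ℕ × ℕ → ℂ⟦X⟧⟦X⟧) (m : ℕ)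
    (ha0 : ∀ d ∈ Δ, a d ≠ 0)
    (haG : ∀ d ∈ Δ, ∀ n : ℕ, PowerSeries.coeff n (a d) ∈ GevreyAut.gevreyDisc s r hs)
    (hm : IsGreatest
      ((fun d : ℕ × ℕ => (d.1 : ℤ) - (GevreyAut.ordT a d : ℤ)) '' (Δ : Set (ℕ × ℕ))) (m : ℤ))
    (h_a : ∀ n : ℕ,
      GevreyAut.IsLowerOrdinate (GevreyAut.newtonPolygon (GevreyAut.tildeP Δ a m n)) 0)
    (h_b : ∀ n : ℕ, (ENNReal.ofReal s)⁻¹ ≤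
      GevreyAut.firstPositiveSlope (GevreyAut.newtonPolygon (GevreyAut.tildeP Δ a m n)))
    (h_c : ∃ C₀ : ℝ, 0 < C₀ ∧ ∀ n k : ℕ, C₀ ≤ ‖GevreyAut.bigW Δ a m n k‖) :
    (GevreyAut.InducesAut (GevreyAut.fullOp Δ a m) (GevreyAut.gevreySeries s hs) ↔
      GevreyAut.alpha Δ a m s = 0) ∧
    (GevreyAut.InducesAut (GevreyAut.fullOp Δ a m) (GevreyAut.gevreySeries s hs) ↔
      ∀ j k : ℕ, (k : ℝ) = (j : ℝ) * s →
        GevreyAut.degW Δ a m (GevreyAut.pIndex Δ a m + k) j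
          ≤ GevreyAut.degW Δ a m (GevreyAut.pIndex Δ a m) 0) := by
  open GevreyAut in
  obtain ⟨c, hc, hW⟩ := h_c
  have hW0 : ∀ n k, bigW Δ a m n k ≠ 0 := fun n k => norm_pos_iff.1 (hc.trans_le (hW n k))
  have hne : (deltaM Δ a m).Nonempty := by
    obtain ⟨d, hd, he⟩ := hm.1
    exact ⟨d, mem_deltaM.2 ⟨hd, he⟩⟩
  -- With l = 0 the numbers W(n,k,0) become the diagonal entries of P̃_m(n,∂_z).
  have hl := lowerIndex_eq_zero (h_a 0) (hW0 0 0)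
  obtain ⟨A, B, hA, hB, hG⟩ := exists_gevrey_leadT (m := m) hs haG
  have hLQ : ∀ (n : ℕ) (u : ℂ⟦X⟧⟦X⟧), (∀ i < n, PowerSeries.coeff i u = 0) →
      PowerSeries.coeff n (fullOp Δ a m u) =
        diffOp (tildeP Δ a m n) (orderBound Δ a m) (PowerSeries.coeff n u) := fun n u hu =>
    coeff_fullOp_of_lt (fun d hd => hm.2 ⟨d, hd, rfl⟩) hu
  have hbij : ∀ n, Function.Bijective (diffOp (tildeP Δ a m n) (orderBound Δ a m)) := fun n =>
    diffOp_bijective (coeff_eq_zero_of_isLowerOrdinate (h_a n)) fun k => by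
      rw [opCoeff_tildeP hl]
      exact hW0 n k
  have hiff : InducesAut (fullOp Δ a m) (gevreySeries s hs) ↔
      ∀ j k : ℕ, (k : ℝ) = (j : ℝ) * s →
        degW Δ a m (pIndex Δ a m + k) j ≤ degW Δ a m (pIndex Δ a m) 0 := by
    constructor
    · intro hL
      by_contra! hdeg
      obtain ⟨j, k, hjk, hlt⟩ := hdeg
      exact not_inducesAut_of_triangular hLQ hbij (fun n => diffOp_sub _ _)
        (fun ρ hρ => eventually_exists_preimage_notMem hs hA hB hG ha0 hne hl h_a h_b hW0
          hjk hlt hρ) hL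
    · intro hdeg
      obtain ⟨C, hC, hsmall⟩ := exists_smallRatio hs hA hB hG ha0 hne hl h_a h_b hdeg
      obtain ⟨ρ₀, hρ₀, hmem⟩ := exists_radius_of_smallRatio hs hB hC hc hl hW hsmall
      exact inducesAut_of_triangular hr hLQ
        (fun ρ hρ hρr u hu => coeffMem_fullOp m haG hρ hρr hu) hbij hρ₀ hmem
  exact ⟨hiff.trans (alpha_eq_zero_iff Δ a m s).symm, hiff⟩
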